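/- Let $K$ be a Noetherian commutative ring and let $\mathbf{FI}$ be the category of finite sets with injections. An $\mathbf{FI}$-algebra over $K$ is a covariant functor from $\mathbf{FI}$ to commutative unital $K$-algebras, and a morphism of $\mathbf{FI}$-algebras is a natural transformation. A set $D\subseteq\bigsqcup_S A(S)$ generates $A$ if no proper $\mathbf{FI}$-subalgebra of $A$ contains $D$, and $A$ is finitely generated if some finite $D$ generates it. The width of $f\in A(S)$ is the minimal $n$ such that $f\in A(\pi)A([n])$ for some injection $\pi:[n]\to S$, and $A$ is generated in width at most $d$ if it is generated by a collection of elements of width at most $d$. An $\mathbf{FI}$-ideal $I$ of $A$ is a family of ideals $I(S)\subseteq A(S)$ with $A(\pi)I(S)\subseteq I(T)$ for every injection $\pi:S\to T$; it is finitely generated if it is the smallest $\mathbf{FI}$-ideal containing some finite set of elements; its radical $\operatorname{rad}(I)$ is taken in each $A(S)$. An $\mathbf{FI^{op}}$-scheme over $K$ is a contravariant functor $X$ from $\mathbf{FI}$ to $K$-schemes; a closed subscheme $Z$ of $X$ is a subfunctor with each $Z(S)$ a closed subscheme of $X(S)$, and $Z$ is reduced if each $Z(S)$ is. We call $X$ topologically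 Noetherian if every descending chain $Z_0\supseteq Z_1\supseteq\cdots$ of reduced closed subschemes of $X$ stabilises. **Theorem.** Let $\phi:B\to A$ be a morphism of finitely generated $\mathbf{FI}$-algebras over $K$, and suppose that $A$ is generated in width at most $1$. Let $\phi^*:\operatorname{Spec}A\to\operatorname{Spec}B$ be the dual morphism of $\mathbf{FI^{op}}$-schemes, and let $\overline{\operatorname{Im}(\phi^*)}$ be the reduced closed subscheme of $\operatorname{Spec}B$ whose underlying set, for each finite set $S$, is the Zariski closure of the image of $\operatorname{Spec}A(S)\to\operatorname{Spec}B(S)$. Then: 1. $\overline{\operatorname{Im}(\phi^*)}$ is defined, as a set, by finitely many elements of $B$: there are finitely many elements $f_1\in B(S_1),\dots,f_m\in B(S_m)$ such that, for every finite set $S$, a prime $p$ of $B(S)$ lies in $\overline{\operatorname{Im}(\phi^*)}(S)$ if and only if $B(\sigma)f_i\in p$ for all $i$ and all injections $\sigma:S_i\to S$. 2. Equivalently, there is a finitely generated $\mathbf{FI}$-ideal $I$ of $B$ with $\operatorname{rad}(I)=\operatorname{rad}(\operatorname{Ker}\phi)$. 3. $\overline{\operatorname{Im}(\phi^*)}$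 is topologically Noetherian. -/

import Mathlib

open CategoryTheory AlgebraicGeometry

universe u

/-! ### The category of finite sets and injections -/

/-- Objects of `FI`: finite sets. -/
structure FI : Type 1 where
  of ::
  carrier : Type
  [finite : Finite carrier]

attribute [instance] FI.finite

/-- Morphisms of `FI`: injective maps. -/
instance FI.instCategory : Category FI where
  Hom S T := S.carrier ↪ T.carrier
  id S := Function.Embedding.refl S.carrier
  comp f g := Function.Embedding.trans f g

/-- The finite set `[n]` with `n` elements. -/
def FI.fin (n : ℕ) : FI := FI.of (Fin n)

/-! ### FI-algebras -/

/-- An FI-algebra over `K`: a covariant functor from `FI` to commutative unital `K`-algebras.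
Morphisms of FI-algebras are natural transformations. -/
abbrev FIAlgebra (K : Type u) [CommRing K] := FI ⥤ CommAlgCat.{u} K

namespace FIAlgebra

variable {K : Type u} [CommRing K]

/-- The disjoint union of all `A(S)`. -/
abbrev Element (A : FIAlgebra K) := Σ S : FI, A.obj S

/-- A sub-FI-algebra: a family of subalgebras `B(S) ⊆ A(S)` preserved by the maps of `A`. -/
structure Sub (A : FIAlgebra K) where
  obj : ∀ S : FI, Subalgebra K (A.obj S)
  map_mem : ∀ {S T : FI} (f : S ⟶ T) {a : A.obj S}, a ∈ obj S → (A.map f).hom a ∈ obj T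

/-- `A` is generated by `D`: the set `D` is contained in no proper subalgebra of `A`. -/
def IsGeneratedBy (A : FIAlgebra K) (D : Set A.Element) : Prop :=
  ∀ C : A.Sub, (∀ x ∈ D, x.2 ∈ C.obj x.1) → ∀ S : FI, C.obj S = ⊤

/-- `A` is finitely generated. -/
def IsFinitelyGenerated (A : FIAlgebra K) : Prop :=
  ∃ D : Set A.Element, D.Finite ∧ A.IsGeneratedBy D

/-- The width of `x ∈ A(S)`: the minimal `n` such that `x` lies in `A(π) A([n])` for some
injection `π : [n] → S`. -/
noncomputable def width (A : FIAlgebra K) (x : A.Element) : ℕ :=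
  sInf {n : ℕ | ∃ (π : FI.fin n ⟶ x.1) (a : A.obj (FI.fin n)), (A.map π).hom a = x.2}

/-- The set in the definition of the width is non-empty. -/
theorem width_set_nonempty (A : FIAlgebra K) (x : A.Element) :
    {n : ℕ | ∃ (π : FI.fin n ⟶ x.1) (a : A.obj (FI.fin n)), (A.map π).hom a = x.2}.Nonempty := by
  let e := Finite.equivFin x.1.carrier
  let π : FI.fin (Nat.card x.1.carrier) ⟶ x.1 := e.symm.toEmbedding
  let ρ : x.1 ⟶ FI.fin (Nat.card x.1.carrier) := e.toEmbedding
  have h : ρ ≫ π = 𝟙 x.1 := by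
    apply Function.Embedding.ext
    intro i
    exact e.symm_apply_apply i
  refine ⟨Nat.card x.1.carrier, π, (A.map ρ).hom x.2, ?_⟩
  rw [← CommAlgCat.comp_apply, ← A.map_comp, h, A.map_id]
  rfl

/-- `A` is generated in width at most `d`: some collection of elements of width at most `d`
generates `A`. -/
def IsGeneratedInWidthLE (A : FIAlgebra K) (d : ℕ) : Prop :=
  ∃ D : Set A.Element, (∀ x ∈ D, A.width x ≤ d) ∧ A.IsGeneratedBy D

/-- An FI-ideal of `A`. -/
@[ext]
structure FIIdeal (A : FIAlgebra K) where
  obj : ∀ S : FI, Ideal (A.obj S)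
  map_mem : ∀ {S T : FI} (f : S ⟶ T) {a : A.obj S}, a ∈ obj S → (A.map f).hom a ∈ obj T

/-- An FI-ideal `I` is finitely generated: it is the smallest FI-ideal containing some finite
set of elements. -/
def FIIdeal.IsFinitelyGenerated {A : FIAlgebra K} (I : A.FIIdeal) : Prop :=
  ∃ D : Set A.Element, D.Finite ∧ (∀ x ∈ D, x.2 ∈ I.obj x.1) ∧
    ∀ J : A.FIIdeal, (∀ x ∈ D, x.2 ∈ J.obj x.1) → ∀ S : FI, I.obj S ≤ J.obj S

/-- The radical of an FI-ideal, taken in each `A(S)`. -/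
def FIIdeal.radical {A : FIAlgebra K} (I : A.FIIdeal) : A.FIIdeal where
  obj S := (I.obj S).radical
  map_mem f := by
    rintro a ⟨n, hn⟩
    exact ⟨n, by simpa using I.map_mem f hn⟩

/-- The kernel of a morphism of FI-algebras. -/
def ker {B A : FIAlgebra K} (φ : B ⟶ A) : B.FIIdeal where
  obj S := RingHom.ker (φ.app S).hom
  map_mem {S T} f b hb := by
    rw [RingHom.mem_ker] at hb ⊢
    rw [← CommAlgCat.comp_apply, φ.naturality, CommAlgCat.comp_apply, hb, map_zero]

end FIAlgebra

/-! ### FI^op-schemes -/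

/-- An FI^op-scheme over `K`: a contravariant functor from `FI` to schemes over `K`. -/
abbrev FIOpScheme (K : Type u) [CommRing K] := FIᵒᵖ ⥤ Over (Spec (CommRingCat.of K))

namespace FIOpScheme

variable {K : Type u} [CommRing K]

/-- The underlying scheme of `X(S)`. -/
noncomputable abbrev at_ (X : FIOpScheme K) (S : FI) : Scheme.{u} := (X.obj (Opposite.op S)).left

/-- The morphism `X(T) ⟶ X(S)` attached to an injection `S → T`. -/
noncomputable abbrev res (X : FIOpScheme K) {S T : FI} (f : S ⟶ T) : X.at_ T ⟶ X.at_ S := (X.map f.op).left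

/-- A closed subscheme of an FI^op-scheme `X`: closed subschemes `Z(S)` of `X(S)`, given by their
(quasi-coherent) ideal sheaves, such that every `X(T) ⟶ X(S)` restricts to a morphism
`Z(T) ⟶ Z(S)`. -/
@[ext]
structure ClosedSubscheme (X : FIOpScheme K) where
  ideal : ∀ S : FI, (X.at_ S).IdealSheafData
  exists_restriction : ∀ {S T : FI} (f : S ⟶ T),
    ∃ g : (ideal T).subscheme ⟶ (ideal S).subscheme,
      g ≫ (ideal S).subschemeι = (ideal T).subschemeι ≫ X.res f

namespace ClosedSubscheme

variable {X : FIOpScheme K}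

/-- `Z ≤ Z'` if `Z(S)` is a closed subscheme of `Z'(S)` for all `S`. -/
instance : LE X.ClosedSubscheme where
  le Z Z' := ∀ S : FI, Z'.ideal S ≤ Z.ideal S

/-- The underlying closed subset of `X(S)`. -/
def support (Z : X.ClosedSubscheme) (S : FI) : Set (X.at_ S) := (Z.ideal S).support

/-- `Z` is reduced: every `Z(S)` is a reduced scheme. -/
def IsReduced (Z : X.ClosedSubscheme) : Prop :=
  ∀ S : FI, AlgebraicGeometry.IsReduced (Z.ideal S).subscheme

/-- A closed subscheme of `X`, as an FI^op-scheme in its own right. -/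
noncomputable def toFIOpScheme (Z : X.ClosedSubscheme) : FIOpScheme K where
  obj S := Over.mk ((Z.ideal S.unop).subschemeι ≫ (X.obj S).hom)
  map {T S} f := Over.homMk (Z.exists_restriction f.unop).choose (by
    have h := (Z.exists_restriction f.unop).choose_spec
    have hw := Over.w (X.map f)
    simp only [Over.mk_left, Over.mk_hom]
    rw [reassoc_of% h]
    exact congrArg _ hw)
  map_id S := by
    ext1
    rw [← cancel_mono (Z.ideal S.unop).subschemeι]
    have h := (Z.exists_restriction (𝟙 S.unop)).choose_spec
    refine h.trans ?_
    simp [res]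
  map_comp {S T U} f g := by
    ext1
    rw [← cancel_mono (Z.ideal U.unop).subschemeι]
    have h := (Z.exists_restriction (f ≫ g).unop).choose_spec
    have h₁ := (Z.exists_restriction f.unop).choose_spec
    have h₂ := (Z.exists_restriction g.unop).choose_spec
    refine h.trans ?_
    simp only [Over.comp_left, Over.homMk_left, Category.assoc]
    erw [h₂, reassoc_of% h₁]
    simp [res]

end ClosedSubscheme

/-- `X` is topologically Noetherian: every descending chain of reduced closed subschemes of the
FI^op-scheme `X` stabilises. -/
def IsTopologicallyNoetherian (X : FIOpScheme K) : Prop :=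
  ∀ Z : ℕ → X.ClosedSubscheme, (∀ n, (Z n).IsReduced) → (∀ n, Z (n + 1) ≤ Z n) →
    ∃ N, ∀ n, N ≤ n → Z n = Z N

/-- The Zariski closure of the image of a morphism `f : Y ⟶ X` of FI^op-schemes, as a closed
subscheme of `X`: for each `S` the closure of the image of `Y(S)` in `X(S)`, with its reduced
scheme structure. -/
noncomputable def imageClosure {Y X : FIOpScheme K} (f : Y ⟶ X) : X.ClosedSubscheme where
  ideal S := Scheme.IdealSheafData.vanishingIdeal
    ⟨closure (Set.range (f.app (Opposite.op S)).left), isClosed_closure⟩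
  exists_restriction {S T} g := by
    refine ⟨Scheme.IdealSheafData.subschemeMap _ _ (X.res g) ?_,
      Scheme.IdealSheafData.subschemeMap_subschemeι _ _ _ _⟩
    rw [Scheme.IdealSheafData.map_vanishingIdeal]
    apply Scheme.IdealSheafData.vanishingIdeal_antimono
    have hn : (f.app (Opposite.op T)).left ≫ X.res g =
        Y.res g ≫ (f.app (Opposite.op S)).left :=
      (congrArg CommaMorphism.left (f.naturality g.op)).symm
    refine TopologicalSpace.Closeds.closure_le.mpr ?_
    refine (image_closure_subset_closure_image (X.res g).continuous).trans (closure_mono ?_)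
    rintro _ ⟨_, ⟨y, rfl⟩, rfl⟩
    refine ⟨Y.res g y, ?_⟩
    rw [← Scheme.Hom.comp_apply, ← Scheme.Hom.comp_apply, hn]

/-- The points of the image closure are the closure of the image. -/
theorem support_imageClosure {Y X : FIOpScheme K} (f : Y ⟶ X) (S : FI) :
    (imageClosure f).support S = closure (Set.range (f.app (Opposite.op S)).left) :=
  Scheme.IdealSheafData.coe_support_vanishingIdeal _

/-- The image closure is reduced. -/
theorem imageClosure_isReduced {Y X : FIOpScheme K} (f : Y ⟶ X) : (imageClosure f).IsReduced := by
  intro S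
  have (U : ((imageClosure f).ideal S).subschemeCover.openCover.I₀) :
      AlgebraicGeometry.IsReduced (((imageClosure f).ideal S).subschemeCover.openCover.X U) := by
    have h : (((imageClosure f).ideal S).ideal U).IsRadical :=
      PrimeSpectrum.isRadical_vanishingIdeal _
    have h' : _root_.IsReduced (Γ(X.at_ S, U.1) ⧸ ((imageClosure f).ideal S).ideal U) :=
      (Ideal.isRadical_iff_quotient_reduced _).mp h
    exact inferInstanceAs (AlgebraicGeometry.IsReduced
      (Spec (.of (Γ(X.at_ S, U.1) ⧸ ((imageClosure f).ideal S).ideal U))))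
  exact IsReduced.of_openCover _ ((imageClosure f).ideal S).subschemeCover.openCover

end FIOpScheme

namespace FIAlgebra

variable {K : Type u} [CommRing K]

/-- The spectrum of an FI-algebra. -/
noncomputable def spec (A : FIAlgebra K) : FIOpScheme K :=
  A.op ⋙ algSpec (CommRingCat.of K)

/-- The morphism `φ^* : Spec A ⟶ Spec B` dual to a morphism `φ : B ⟶ A` of FI-algebras. -/
noncomputable def specMap {B A : FIAlgebra K} (φ : B ⟶ A) : A.spec ⟶ B.spec :=
  Functor.whiskerRight (NatTrans.op φ) (algSpec (CommRingCat.of K))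

/-- On points, `Spec A(S) ⟶ Spec B(S)` is the contraction of prime ideals along `φ_S`. -/
theorem specMap_app_apply {B A : FIAlgebra K} (φ : B ⟶ A) (S : FI) (p : PrimeSpectrum (A.obj S)) :
    ((specMap φ).app (Opposite.op S)).left p =
      (PrimeSpectrum.comap (φ.app S).hom.toRingHom p : PrimeSpectrum (B.obj S)) :=
  rfl

/-- The closed subset of `Spec B(S)` defined by elements `D` of `B`: the primes `p` of `B(S)` such
that `B(σ) b ∈ p` for all `b ∈ B(T)` in `D` and all injections `σ : T → S`. -/
def zeroLocus (B : FIAlgebra K) (D : Set B.Element) (S : FI) : Set (B.spec.at_ S) :=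
  {p : PrimeSpectrum (B.obj S) | ∀ x ∈ D, ∀ σ : x.1 ⟶ S, (B.map σ).hom x.2 ∈ p.asIdeal}

end FIAlgebra

/-!
Generators of `B` turn a prime of `B(S)` into a family of tensors over its residue field: the
images of a generator of `B(T)` under the injections `T → S` are the entries of a tensor whose
indices run through `S`. Since `A` is generated in width at most one, an element of `A(T)` is a sum
of products of elements that involve one point of `T` and elements that involve the other points.
So the flattenings of the tensors coming from `A` have bounded rank, and `ker φ` contains all
minors of some size `N + 1`. These are the translates of finitely many elements of `B`, and it
suffices to show that families of tensors of bounded rank satisfy the descending chain condition.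

Where a non-zero minor of maximal size is fixed, Cramer's rule expresses the entries of the tensor
in terms of those having some index in the finite set of indices of that minor. Splitting off this
finite set replaces the tensor by tensors with fewer indices, over the ring of coefficients with
the inverse of the minor adjoined. By induction on the rank and on the number of indices, there
remain tensors with at most one index. These are the points of polynomial rings in rows of
variables, which are Noetherian up to increasing maps of rows by a theorem of Cohen: the ideals of
leading coefficients grow along divisibility of monomials up to such maps, and that relation is a
well-quasi-order by Higman's lemma.
-/

/-! ### Minors of flattenings -/

theorem eq_mul_adjugate_mul_of_det_fromBlocks_eq_zero {F n : Type*} [Field F] [Fintype n]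
    [DecidableEq n] {A : Matrix n n F} {B : Matrix n Unit F} {C : Matrix Unit n F}
    {D : Matrix Unit Unit F} (hA : A.det ≠ 0) (h : (Matrix.fromBlocks A B C D).det = 0) :
    D = C * (A.det⁻¹ • A.adjugate) * B := by
  have : Invertible A := Matrix.invertibleOfIsUnitDet A (isUnit_iff_ne_zero.mpr hA)
  rw [Matrix.det_fromBlocks₁₁, Matrix.det_unique (n := Unit)] at h
  have hD := sub_eq_zero.mp ((mul_eq_zero.mp h).resolve_left hA)
  rw [Matrix.invOf_eq_nonsing_inv, Matrix.inv_def, Ring.inverse_eq_inv'] at hD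
  exact Matrix.ext fun _ _ => hD

theorem injective_update_iff {V S : Type*} [DecidableEq V] {g : V → S} {w : V} {x : S} :
    Function.Injective (Function.update g w x) ↔
      (∀ v v', v ≠ w → v' ≠ w → g v = g v' → v = v') ∧ ∀ v, v ≠ w → g v ≠ x := by
  constructor
  · intro h
    refine ⟨fun v v' hv hv' e => h (by simpa [hv, hv'] using e), fun v hv e => hv (h ?_)⟩
    simpa [hv] using e
  · rintro ⟨hinj, hne⟩ v v' e
    by_cases hv : v = w <;> by_cases hv' : v' = w
    · rw [hv, hv']
    · simp only [hv, Function.update_self, Function.update_of_ne hv'] at e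
      exact (hne v' hv' e.symm).elim
    · simp only [hv', Function.update_self, Function.update_of_ne hv] at e
      exact (hne v hv e).elim
    · simp only [Function.update_of_ne hv, Function.update_of_ne hv'] at e
      exact hinj v v' hv hv' e

namespace Flattening

section

variable {R R' V S S' ι ι' κ κ' : Type*}

open scoped Classical in
/-- The submatrix with rows `a` and columns `c` of the flattening of a tensor `y` along the
position `w`. A column is a full index of `y`, whose value at `w` is ignored. -/
noncomputable def block (y : (V → S) → R) (w : V) (a : ι → S) (c : κ → V → S) : Matrix ι κ R :=
  Matrix.of fun i m => y (Function.update (c m) w (a i))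

open scoped Classical in
/-- Rows `a` and columns `c` of a flattening all of whose common entries have pairwise distinct
indices. -/
def IsAdmissible (w : V) (a : ι → S) (c : κ → V → S) : Prop :=
  ∀ i m, Function.Injective (Function.update (c m) w (a i))

theorem block_sumElim (y : (V → S) → R) (w : V) (a : ι → S) (a' : ι' → S) (c : κ → V → S)
    (c' : κ' → V → S) :
    block y w (Sum.elim a a') (Sum.elim c c') =
      Matrix.fromBlocks (block y w a c) (block y w a c') (block y w a' c) (block y w a' c') := by
  ext (i | i) (m | m) <;> rfl

theorem IsAdmissible.comp {w : V} {a : ι → S} {c : κ → V → S} (h : IsAdmissible w a c) {g : S → S'}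
    (hg : Function.Injective g) : IsAdmissible w (g ∘ a) (fun m => g ∘ c m) := by
  classical
  intro i m
  have hgim := hg.comp (h i m)
  rwa [Function.comp_update] at hgim

theorem IsAdmissible.of_comp {w : V} {a : ι → S} {c : κ → V → S} {g : S → S'}
    (h : IsAdmissible w (g ∘ a) (fun m => g ∘ c m)) : IsAdmissible w a c := by
  classical
  intro i m
  have hgim : Function.Injective (Function.update (g ∘ c m) w (g (a i))) := h i m
  rw [← Function.comp_update] at hgim
  exact hgim.of_comp

variable [CommRing R] [CommRing R']

/-- All admissible minors of size `r` of the flattening of `y` along `w` vanish. Entries of `y` at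
non-injective indices are thus disregarded. -/
def MinorsVanish (y : (V → S) → R) (w : V) (r : ℕ) : Prop :=
  ∀ (a : Fin r → S) (c : Fin r → V → S), IsAdmissible w a c → (block y w a c).det = 0

/-- The value that Cramer's rule predicts for the entry `f` of a tensor `y`, all of whose
flattenings along `w` have the rank of the block with rows `a` and columns `c`; the scalar `x`
stands for the inverse of the determinant of this block. -/
noncomputable def cramer [Fintype ι] [DecidableEq ι] (y : (V → S) → R) (w : V) (a : ι → S)
    (c : ι → V → S) (x : R) (f : V → S) : R :=
  (block y w (fun _ : Unit => f w) c * (x • (block y w a c).adjugate) *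
    block y w a fun _ : Unit => f) () ()

open scoped Classical in
theorem map_block {y : (V → S) → R} {y' : (V → S') → R'} {w : V} {c : κ → V → S} (φ : R →+* R')
    (g : S → S') (h : ∀ m s, φ (y (Function.update (c m) w s)) = y' (g ∘ Function.update (c m) w s))
    (a : ι → S) : (block y w a c).map φ = block y' w (g ∘ a) (fun m => g ∘ c m) := by
  ext i m
  exact (h m (a i)).trans (congrArg y' (Function.comp_update g _ _ _))

open scoped Classical in
theorem map_cramer [Fintype ι] [DecidableEq ι] {y : (V → S) → R} {y' : (V → S') → R'} {w : V}
    {a : ι → S} {c : ι → V → S} {f : V → S} (φ : R →+* R') (g : S → S')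
    (hc : ∀ m s, φ (y (Function.update (c m) w s)) = y' (g ∘ Function.update (c m) w s))
    (hf : ∀ i, φ (y (Function.update f w (a i))) = y' (g ∘ Function.update f w (a i))) (x : R) :
    φ (cramer y w a c x f) = cramer y' w (g ∘ a) (fun m => g ∘ c m) (φ x) (g ∘ f) := by
  have hcol : (block y w a fun _ : Unit => f).map φ = block y' w (g ∘ a) fun _ => g ∘ f := by
    ext i -
    exact (hf i).trans (congrArg y' (Function.comp_update g _ _ _))
  have hadj : (x • (block y w a c).adjugate).map φ =
      φ x • (block y' w (g ∘ a) fun m => g ∘ c m).adjugate := by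
    rw [Matrix.map_smul' _ _ _ (map_mul φ), ← map_block φ g hc]
    exact congrArg _ (φ.map_adjugate _)
  rw [cramer, ← Matrix.map_apply (f := φ), Matrix.map_mul, Matrix.map_mul, hcol, hadj,
    map_block φ g hc]
  rfl

theorem MinorsVanish.det_eq_zero [Fintype ι] [DecidableEq ι] {y : (V → S) → R} {w : V} {r : ℕ}
    (hy : MinorsVanish y w r) (hι : Fintype.card ι = r) {a : ι → S} {c : ι → V → S}
    (hac : IsAdmissible w a c) : (block y w a c).det = 0 := by
  let e := Fintype.equivFinOfCardEq hι
  rw [← Matrix.det_submatrix_equiv_self e.symm]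
  exact hy (a ∘ e.symm) (c ∘ e.symm) fun i m => hac (e.symm i) (e.symm m)

theorem not_minorsVanish_zero [Nontrivial R] (y : (V → S) → R) (w : V) : ¬ MinorsVanish y w 0 :=
  fun h => one_ne_zero (Matrix.det_fin_zero.symm.trans (h Fin.elim0 Fin.elim0 fun i => i.elim0))

end

theorem MinorsVanish.eq_cramer {F V S ι : Type*} [Field F] [Fintype ι] [DecidableEq ι]
    {y : (V → S) → F} {w : V}
    (hy : MinorsVanish y w (Fintype.card ι + 1)) {a : ι → S} {c : ι → V → S}
    (hac : IsAdmissible w a c) (hdet : (block y w a c).det ≠ 0) {f : V → S}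
    (hf : Function.Injective f) (hfa : ∀ v, v ≠ w → ∀ i, f v ≠ a i)
    (hfc : ∀ m v, v ≠ w → f w ≠ c m v) :
    y f = cramer y w a c (block y w a c).det⁻¹ f := by
  classical
  have hadm : IsAdmissible w (Sum.elim a fun _ : Unit => f w) (Sum.elim c fun _ : Unit => f) := by
    rintro (i | -) (m | -)
    · exact hac i m
    · exact injective_update_iff.mpr ⟨fun v v' _ _ h => hf h, fun v hv => hfa v hv i⟩
    · exact injective_update_iff.mpr ⟨(injective_update_iff.mp (hac m m)).1,
        fun v hv => (hfc m v hv).symm⟩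
    · simpa only [Sum.elim_inr, Function.update_eq_self] using hf
  have hzero := hy.det_eq_zero (by simp) hadm
  rw [block_sumElim] at hzero
  calc
    y f = block y w (fun _ : Unit => f w) (fun _ : Unit => f) () () := by simp [block]
    _ = cramer y w a c (block y w a c).det⁻¹ f :=
      congrFun₂ (eq_mul_adjugate_mul_of_det_fromBlocks_eq_zero hdet hzero) () ()

end Flattening

/-! ### Families of tensors and their equations -/

/-- The variables of the coordinate ring of the families of tensors `y j : (W j → T) → Ω`. -/
abbrev TensorVar {J : Type} (W : J → Type) (T : Type) : Type := Σ j, (W j → T)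

/-- A point of the space of families of tensors over an arbitrary, possibly infinite, index set
`S`, with entries in a field over `K`. Only the entries at injective indices carry information;
the other ones are normalised to zero. -/
structure TensorPoint (K : Type u) [CommRing K] {J : Type} (W : J → Type) where
  S : Type
  Ω : Type u
  [field : Field Ω]
  coeff : K →+* Ω
  y : ∀ j, (W j → S) → Ω
  y_eq_zero : ∀ j f, ¬ Function.Injective f → y j f = 0

attribute [instance] TensorPoint.field

/-- A polynomial in the entries of a family of tensors over a finite index set; it stands for the
system of all its translates along injections of index sets. -/
abbrev TensorEquation (K : Type u) [CommRing K] {J : Type} (W : J → Type) :=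
  Σ T : FI, MvPolynomial (TensorVar W T.carrier) K

namespace TensorPoint

variable {K : Type u} [CommRing K] {J : Type} {W : J → Type}

/-- Evaluation of polynomials in the entries of tensors at `M`, along a map of index sets. -/
noncomputable def eval (M : TensorPoint K W) {T : Type} (σ : T → M.S) :
    MvPolynomial (TensorVar W T) K →+* M.Ω :=
  MvPolynomial.eval₂Hom M.coeff fun v => M.y v.1 (σ ∘ v.2)

/-- `M` satisfies an equation if all translates of the equation along injections vanish at `M`. -/
def Satisfies (M : TensorPoint K W) (F : TensorEquation K W) : Prop :=
  ∀ σ : F.1.carrier → M.S, Function.Injective σ → M.eval σ F.2 = 0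

/-- A class of points on which every system of equations is equivalent to a finite subsystem. -/
def IsEquationallyNoetherian (C : Set (TensorPoint K W)) : Prop :=
  ∀ E : Set (TensorEquation K W), ∃ E₀ ⊆ E, E₀.Finite ∧
    ∀ M ∈ C, (∀ F ∈ E₀, M.Satisfies F) → ∀ F ∈ E, M.Satisfies F

namespace IsEquationallyNoetherian

variable {C C' : Set (TensorPoint K W)}

theorem mono (h : C ⊆ C') (hC : IsEquationallyNoetherian C') : IsEquationallyNoetherian C := by
  intro E
  obtain ⟨E₀, hsub, hfin, hE⟩ := hC E
  exact ⟨E₀, hsub, hfin, fun M hM => hE M (h hM)⟩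

theorem empty : IsEquationallyNoetherian (∅ : Set (TensorPoint K W)) :=
  fun _ => ⟨∅, Set.empty_subset _, Set.finite_empty, fun _ h => h.elim⟩

theorem iUnion {ι : Type*} [Finite ι] {C : ι → Set (TensorPoint K W)}
    (h : ∀ i, IsEquationallyNoetherian (C i)) : IsEquationallyNoetherian (⋃ i, C i) := by
  intro E
  choose E₀ hsub hfin hE using fun i => h i E
  refine ⟨⋃ i, E₀ i, Set.iUnion_subset hsub, Set.finite_iUnion hfin, fun M hM hs => ?_⟩
  obtain ⟨i, hi⟩ := Set.mem_iUnion.mp hM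
  exact hE i M hi fun F hF => hs F (Set.mem_iUnion_of_mem i hF)

theorem union (h : IsEquationallyNoetherian C) (h' : IsEquationallyNoetherian C') :
    IsEquationallyNoetherian (C ∪ C') := by
  rw [Set.union_eq_iUnion]
  exact iUnion (by rintro (_ | _) <;> assumption)

theorem of_translation {K' : Type u} [CommRing K'] {J' : Type} {W' : J' → Type}
    {C' : Set (TensorPoint K' W')} (hC' : IsEquationallyNoetherian C')
    (tr : TensorEquation K W → Set (TensorEquation K' W'))
    (h : ∀ M ∈ C, ∃ M' ∈ C', ∀ F, M.Satisfies F ↔ ∀ G ∈ tr F, M'.Satisfies G) :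
    IsEquationallyNoetherian C := by
  intro E
  obtain ⟨E', hsub, hfin, hE'⟩ := hC' (⋃ F ∈ E, tr F)
  have hsource : ∀ G : E', ∃ F ∈ E, G.1 ∈ tr F := fun G => by simpa using hsub G.2
  choose source hsourceE hsource using hsource
  have := hfin.to_subtype
  refine ⟨Set.range source, Set.range_subset_iff.mpr hsourceE, Set.finite_range source, ?_⟩
  intro M hM hM₀ F hF
  obtain ⟨M', hM', hMM'⟩ := h M hM
  refine (hMM' F).mpr fun G hG => hE' M' hM' (fun G' hG' => ?_) G (Set.mem_biUnion hF hG)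
  exact (hMM' _).mp (hM₀ _ ⟨⟨G', hG'⟩, rfl⟩) _ (hsource ⟨G', hG'⟩)

end IsEquationallyNoetherian

variable (K W) in
/-- The points all of whose flattenings have rank at most `N`, in the sense that their admissible
minors of size `N + 1` vanish. -/
def rankLE (N : ℕ) : Set (TensorPoint K W) :=
  {M | ∀ j w, Flattening.MinorsVanish (M.y j) w (N + 1)}

end TensorPoint

/-! ### Splitting an index into a fixed and a variable part -/

namespace TensorIndex

variable {V S₀ T T' : Type}

/-- The part of an index in `S₀`, as a partial map. -/
def leftPart (f : V → S₀ ⊕ T) (v : V) : Option S₀ := (f v).getLeft?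

/-- The part of an index in `T`, on the positions left free by `leftPart`. -/
def rightPart (f : V → S₀ ⊕ T) (v : {v // leftPart f v = none}) : T :=
  (f v.1).getRight (Sum.getLeft?_eq_none_iff.mp v.2)

/-- The index with fixed part `p` and variable part `τ`. -/
def glue (p : V → Option S₀) (τ : {v // p v = none} → T) (v : V) : S₀ ⊕ T :=
  match h : p v with
  | some s => Sum.inl s
  | none => Sum.inr (τ ⟨v, h⟩)

theorem glue_of_eq_none {p : V → Option S₀} (τ : {v // p v = none} → T) {v : V}
    (h : p v = none) : glue p τ v = Sum.inr (τ ⟨v, h⟩) := by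
  unfold glue
  split
  · simp_all
  · rfl

theorem glue_of_eq_some {p : V → Option S₀} (τ : {v // p v = none} → T) {v : V} {s : S₀}
    (h : p v = some s) : glue p τ v = Sum.inl s := by
  unfold glue
  split <;> simp_all

theorem glue_leftPart_rightPart (f : V → S₀ ⊕ T) : glue (leftPart f) (rightPart f) = f := by
  funext v
  rcases h : f v with s | t
  · exact glue_of_eq_some _ (by simp [leftPart, h])
  · rw [glue_of_eq_none _ (by simp [leftPart, h])]
    simp [rightPart, h]

theorem map_comp_glue (p : V → Option S₀) (τ : {v // p v = none} → T) (g : T → T') :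
    Sum.map id g ∘ glue p τ = glue p (g ∘ τ) := by
  funext v
  rcases h : p v with _ | s
  · simp [glue_of_eq_none _ h]
  · simp [glue_of_eq_some _ h]

theorem injective_of_glue {p : V → Option S₀} {τ : {v // p v = none} → T}
    (h : Function.Injective (glue p τ)) : Function.Injective τ := by
  rintro ⟨v, hv⟩ ⟨v', hv'⟩ e
  refine Subtype.ext (h ?_)
  rw [glue_of_eq_none _ hv, glue_of_eq_none _ hv', e]

theorem rightPart_injective {f : V → S₀ ⊕ T} (hf : Function.Injective f) :
    Function.Injective (rightPart f) :=
  injective_of_glue ((glue_leftPart_rightPart f).symm ▸ hf)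

theorem glue_injective_iff {p : V → Option S₀} {τ : {v // p v = none} → T} :
    Function.Injective (glue p τ) ↔
      (∀ v v' s, p v = some s → p v' = some s → v = v') ∧ Function.Injective τ := by
  refine ⟨fun h => ⟨fun v v' s hv hv' => h ?_, injective_of_glue h⟩, ?_⟩
  · rw [glue_of_eq_some _ hv, glue_of_eq_some _ hv']
  rintro ⟨hp, hτ⟩ v v' e
  rcases h : p v with _ | s <;> rcases h' : p v' with _ | s'
  · rw [glue_of_eq_none _ h, glue_of_eq_none _ h', Sum.inr.injEq] at e
    exact congrArg Subtype.val (hτ e)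
  · simp [glue_of_eq_none _ h, glue_of_eq_some _ h'] at e
  · simp [glue_of_eq_some _ h, glue_of_eq_none _ h'] at e
  · rw [glue_of_eq_some _ h, glue_of_eq_some _ h', Sum.inl.injEq] at e
    exact hp v v' s h (e ▸ h')

theorem glue_update [DecidableEq V] {p : V → Option S₀} {_ : DecidableEq {v // p v = none}}
    (τ : {v // p v = none} → T) (w : {v // p v = none}) (t : T) :
    glue p (Function.update τ w t) = Function.update (glue p τ) w.1 (Sum.inr t) := by
  funext v
  by_cases hv : v = w.1
  · subst hv
    rw [glue_of_eq_none _ w.2]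
    simp
  · rw [Function.update_of_ne hv]
    rcases h : p v with _ | s
    · rw [glue_of_eq_none _ h, glue_of_eq_none _ h, Function.update_of_ne]
      exact fun e => hv (congrArg Subtype.val e)
    · rw [glue_of_eq_some _ h, glue_of_eq_some _ h]

end TensorIndex

/-! ### Shifting by a finite set and eliminating a tensor -/

namespace Flattening

open TensorIndex

theorem MinorsVanish.comp {R V S S' : Type*} [CommRing R] {y : (V → S') → R} {w : V} {r : ℕ}
    (hy : MinorsVanish y w r) {g : S → S'} (hg : Function.Injective g) :
    MinorsVanish (fun f => y (g ∘ f)) w r := by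
  classical
  intro a c hac
  have hblock : block (fun f => y (g ∘ f)) w a c = block y w (g ∘ a) (fun m => g ∘ c m) := by
    ext i m
    exact congrArg y (Function.comp_update g _ _ _)
  rw [hblock]
  exact hy _ _ (hac.comp hg)

theorem MinorsVanish.comp_glue {R : Type*} [CommRing R] {V S₀ T : Type} {y : (V → S₀ ⊕ T) → R}
    (hy₀ : ∀ f, ¬ Function.Injective f → y f = 0) {p : V → Option S₀} {w : {v // p v = none}}
    {r : ℕ} (hy : MinorsVanish y w.1 (r + 1)) :
    MinorsVanish (fun τ => y (glue p τ)) w (r + 1) := by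
  classical
  intro a c hac
  by_cases hp : ∀ v v' s, p v = some s → p v' = some s → v = v'
  · have hblock : block (fun τ => y (glue p τ)) w a c =
        block y w.1 (Sum.inr ∘ a) (fun m => glue p (c m)) := by
      ext i m
      exact congrArg y (glue_update (c m) w (a i))
    rw [hblock]
    refine hy _ _ fun i m => ?_
    have hinj := glue_injective_iff.mpr ⟨hp, hac i m⟩
    rwa [glue_update] at hinj
  · exact Matrix.det_eq_zero_of_row_eq_zero 0 fun m =>
      hy₀ _ fun h => hp (glue_injective_iff.mp h).1

end Flattening

namespace TensorPoint

open TensorIndex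

variable {K : Type u} [CommRing K] {J : Type} {W : J → Type}

variable (W) in
/-- Indices for the tensors obtained from the tensors of shape `W` by fixing some of their indices
in `S₀`. The tensor `j₀` itself, with no index fixed, is left out. -/
abbrev ShiftIndex (j₀ : J) (S₀ : Type) : Type :=
  {q : Σ j, (W j → Option S₀) // q.1 = j₀ → ∃ v, (q.2 v).isSome}

/-- The shape of a tensor with some of its indices fixed. -/
abbrev shiftShape (j₀ : J) (S₀ : Type) (q : ShiftIndex W j₀ S₀) : Type :=
  {v // q.1.2 v = none}

section shift

variable (j₀ : J) {S₀ T T' : Type}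

open Polynomial in
/-- The tensors obtained from `M` by fixing some of the indices in `S₀` and letting the other ones
run through `T`. The variable of `K[X]` provides room for an additional scalar `x`. -/
noncomputable def shift (M : TensorPoint K W) (κ : S₀ ⊕ T → M.S) (x : M.Ω) :
    TensorPoint K[X] (shiftShape j₀ S₀ : ShiftIndex W j₀ S₀ → Type) where
  S := T
  Ω := M.Ω
  coeff := eval₂RingHom M.coeff x
  y q τ := M.y q.1.1 (κ ∘ glue q.1.2 τ)
  y_eq_zero _ _ hf := M.y_eq_zero _ _ fun h => hf (injective_of_glue h.of_comp)

theorem shift_mem_rankLE {M : TensorPoint K W} {N : ℕ} (hM : M ∈ rankLE K W N)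
    {κ : S₀ ⊕ T → M.S} (hκ : Function.Injective κ) (x : M.Ω) :
    M.shift j₀ κ x ∈ rankLE _ _ N := fun q w =>
  ((hM q.1.1 w.1).comp hκ).comp_glue fun _ hf => M.y_eq_zero _ _ fun h => hf h.of_comp

variable {j₀}

open Polynomial in
/-- Evaluation of polynomials in the entries of tensors at `M.shift j₀ κ x`. -/
noncomputable def shiftEval (M : TensorPoint K W) (κ : S₀ ⊕ T' → M.S) (x : M.Ω) (σ : T → T') :
    MvPolynomial (TensorVar (shiftShape j₀ S₀ : ShiftIndex W j₀ S₀ → Type) T) K[X] →+* M.Ω :=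
  (M.shift j₀ κ x).eval (T := T) σ

open Polynomial in
open scoped Classical in
variable (K j₀) in
/-- The entry `f` of the tensor `j`, as an entry of one of the shifted tensors. It takes the junk
value zero if it is an entry of the tensor that was left out. -/
noncomputable def shiftEntry (j : J) (f : W j → S₀ ⊕ T) :
    MvPolynomial (TensorVar (shiftShape j₀ S₀ : ShiftIndex W j₀ S₀ → Type) T) K[X] :=
  if h : j = j₀ → ∃ v, (leftPart f v).isSome then
    MvPolynomial.X ⟨⟨⟨j, leftPart f⟩, h⟩, rightPart f⟩
  else 0

theorem shiftEval_C_X (M : TensorPoint K W) (κ : S₀ ⊕ T' → M.S) (x : M.Ω) (σ : T → T') :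
    M.shiftEval (j₀ := j₀) κ x σ (MvPolynomial.C Polynomial.X) = x :=
  (MvPolynomial.eval₂Hom_C _ _ _).trans (Polynomial.eval₂_X _ _)

theorem shiftEval_shiftEntry (M : TensorPoint K W) (κ : S₀ ⊕ T' → M.S) (x : M.Ω) (σ : T → T')
    {j : J} {f : W j → S₀ ⊕ T} (h : j = j₀ → ∃ v, (leftPart f v).isSome) :
    M.shiftEval κ x σ (shiftEntry K j₀ j f) = M.y j (κ ∘ Sum.map id σ ∘ f) := by
  calc
    _ = M.y j (κ ∘ glue (leftPart f) (σ ∘ rightPart f)) := by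
      rw [shiftEntry, dif_pos h]
      exact MvPolynomial.eval₂Hom_X' _ _ _
    _ = M.y j (κ ∘ Sum.map id σ ∘ f) := by rw [← map_comp_glue, glue_leftPart_rightPart]

open Polynomial in
open scoped Classical in
variable (K) in
/-- The expression of the entry `f` of the tensor `j` in the shifted tensors, where the entries of
the tensor `j₀` that was left out are given by Cramer's rule. The variable of `K[X]` stands for the
inverse of the minor with rows `a` and columns `c`. -/
noncomputable def shiftSubst {r : ℕ} (w : W j₀) (a : Fin r → S₀) (c : Fin r → W j₀ → S₀) :
    ∀ j, (W j → S₀ ⊕ T) →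
      MvPolynomial (TensorVar (shiftShape j₀ S₀ : ShiftIndex W j₀ S₀ → Type) T) K[X] :=
  Function.update (shiftEntry K j₀) j₀ fun f =>
    if ∃ v, (leftPart f v).isSome then shiftEntry K j₀ j₀ f
    else if Function.Injective f then
      Flattening.cramer (shiftEntry K j₀ j₀) w (Sum.inl ∘ a) (fun m => Sum.inl ∘ c m)
        (MvPolynomial.C X) f
    else 0

section elimination

variable {M : TensorPoint K W} {κ : S₀ ⊕ T' → M.S} (hκ : Function.Injective κ) {r : ℕ}
  {w v₀ : W j₀} (hv₀ : v₀ ≠ w) {a : Fin r → S₀} {c : Fin r → W j₀ → S₀}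
  (hac : Flattening.IsAdmissible w a c) (hM : Flattening.MinorsVanish (M.y j₀) w (r + 1)) {x : M.Ω}
  (hdet : (Flattening.block (M.y j₀) w (κ ∘ Sum.inl ∘ a) fun m => κ ∘ Sum.inl ∘ c m).det * x = 1)
  {σ : T → T'} (hσ : Function.Injective σ)

include hκ hv₀ hac hM hdet hσ

theorem shiftEval_cramer_shiftEntry {f : W j₀ → S₀ ⊕ T} (hf : Function.Injective f)
    (hleft : ∀ v, leftPart f v = none) :
    M.shiftEval κ x σ (Flattening.cramer (shiftEntry K j₀ j₀) w (Sum.inl ∘ a)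
      (fun m => Sum.inl ∘ c m) (MvPolynomial.C Polynomial.X) f) =
        M.y j₀ (κ ∘ Sum.map id σ ∘ f) := by
  classical
  have hg : Function.Injective (κ ∘ Sum.map id σ) :=
    hκ.comp (Sum.map_injective.mpr ⟨Function.injective_id, hσ⟩)
  have hne : ∀ v s, (κ ∘ Sum.map id σ ∘ f) v ≠ κ (Sum.inl s) := fun v s h => by
    have hfv : f v = Sum.inl s := hg h
    simpa [leftPart, hfv] using hleft v
  calc
    _ = Flattening.cramer (M.y j₀) w (κ ∘ Sum.inl ∘ a) (fun m => κ ∘ Sum.inl ∘ c m)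
        (M.shiftEval (j₀ := j₀) κ x σ (MvPolynomial.C Polynomial.X)) (κ ∘ Sum.map id σ ∘ f) := by
      refine Flattening.map_cramer _ (κ ∘ Sum.map id σ) (fun m s => ?_) (fun i => ?_) _
      · exact shiftEval_shiftEntry M κ x σ fun _ => ⟨v₀, by simp [leftPart, hv₀]⟩
      · exact shiftEval_shiftEntry M κ x σ fun _ => ⟨w, by simp [leftPart]⟩
    _ = Flattening.cramer (M.y j₀) w (κ ∘ Sum.inl ∘ a) (fun m => κ ∘ Sum.inl ∘ c m)
        (Flattening.block (M.y j₀) w (κ ∘ Sum.inl ∘ a) fun m => κ ∘ Sum.inl ∘ c m).det⁻¹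
        (κ ∘ Sum.map id σ ∘ f) := by
      rw [shiftEval_C_X, eq_inv_of_mul_eq_one_right hdet]
    _ = M.y j₀ (κ ∘ Sum.map id σ ∘ f) := by
      refine (Flattening.MinorsVanish.eq_cramer ((Fintype.card_fin r).symm ▸ hM)
        (hac.comp (hκ.comp Sum.inl_injective)) (left_ne_zero_of_mul_eq_one hdet) (hg.comp hf)
        (fun v _ i => hne v (a i)) fun m v _ => hne w (c m v)).symm

theorem shiftEval_shiftSubst (j : J) (f : W j → S₀ ⊕ T) :
    M.shiftEval κ x σ (shiftSubst K w a c j f) = M.y j (κ ∘ Sum.map id σ ∘ f) := by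
  classical
  rw [shiftSubst]
  rcases eq_or_ne j j₀ with rfl | hj
  · rw [Function.update_self]
    split_ifs with hleft hf
    · exact shiftEval_shiftEntry M κ x σ fun _ => hleft
    · exact shiftEval_cramer_shiftEntry hκ hv₀ hac hM hdet hσ hf (by simpa using hleft)
    · rw [map_zero, M.y_eq_zero]
      exact fun h => hf (Function.Injective.of_comp (f := κ ∘ Sum.map id σ) h)
  · rw [Function.update_of_ne hj]
    exact shiftEval_shiftEntry M κ x σ fun h => (hj h).elim

theorem shiftEval_eval₂Hom_shiftSubst {U : Type} (θ : U → S₀ ⊕ T)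
    (F : MvPolynomial (TensorVar W U) K) :
    M.shiftEval κ x σ (MvPolynomial.eval₂Hom (MvPolynomial.C.comp Polynomial.C)
      (fun v => shiftSubst K w a c v.1 (θ ∘ v.2)) F) = M.eval (κ ∘ Sum.map id σ ∘ θ) F := by
  rw [← RingHom.comp_apply]
  refine DFunLike.congr_fun (MvPolynomial.ringHom_ext (fun k => ?_) fun v => ?_) F
  · rw [RingHom.comp_apply, MvPolynomial.eval₂Hom_C, eval, MvPolynomial.eval₂Hom_C]
    exact (MvPolynomial.eval₂Hom_C _ _ _).trans (Polynomial.eval₂_C _ _)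
  · rw [RingHom.comp_apply, MvPolynomial.eval₂Hom_X', eval, MvPolynomial.eval₂Hom_X']
    exact shiftEval_shiftSubst hκ hv₀ hac hM hdet hσ v.1 (θ ∘ v.2)

end elimination

end shift

end TensorPoint

namespace TensorPoint

open TensorIndex

/-- The points of rank at most `N` at which the flattening of the tensor `j₀` along `w` has no
non-zero admissible minor of size `r + 1`, but has one of size `r` with rows `a` and columns `c`,
for some embedding of `S₀` into the index set. -/
def exactRank (K : Type u) [CommRing K] {J : Type} (W : J → Type) (N : ℕ) {j₀ : J} (w : W j₀)
    {S₀ : Type} {r : ℕ} (a : Fin r → S₀) (c : Fin r → W j₀ → S₀) : Set (TensorPoint K W) :=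
  {M | M ∈ rankLE K W N ∧ Flattening.MinorsVanish (M.y j₀) w (r + 1) ∧ ∃ ι : S₀ → M.S,
    Function.Injective ι ∧ (Flattening.block (M.y j₀) w (ι ∘ a) fun m => ι ∘ c m).det ≠ 0}

/-- The rows and columns of a minor up to renaming of indices: which of the indices coincide. -/
abbrev MinorPattern (V : Type) (r : ℕ) := Setoid (Fin r ⊕ Fin r × V)

namespace MinorPattern

variable {V : Type} {r : ℕ}

instance [Finite V] : Finite (MinorPattern V r) :=
  Finite.of_injective (fun s : MinorPattern V r => s.r) fun _ _ h =>
    Setoid.ext fun a b => iff_of_eq (congrFun₂ h a b)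

/-- The rows of the universal minor with a given pattern. -/
def row (s : MinorPattern V r) (i : Fin r) : Quotient s := Quotient.mk s (Sum.inl i)

/-- The columns of the universal minor with a given pattern. -/
def col (s : MinorPattern V r) (m : Fin r) (v : V) : Quotient s := Quotient.mk s (Sum.inr (m, v))

theorem exists_eq_comp {S : Type} (a : Fin r → S) (c : Fin r → V → S) :
    ∃ (s : MinorPattern V r) (ι : Quotient s → S), Function.Injective ι ∧ ι ∘ s.row = a ∧
      (fun m => ι ∘ s.col m) = c :=
  ⟨Setoid.ker (Sum.elim a fun p => c p.1 p.2), Setoid.kerLift _, Setoid.kerLift_injective _,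
    rfl, rfl⟩

end MinorPattern

variable {K : Type u} [CommRing K] {J : Type} {W : J → Type}

theorem exists_equiv_sum_of_injective {S S₀ : Type} {ι : S₀ → S} (hι : Function.Injective ι) :
    ∃ (T : Type) (κ : S₀ ⊕ T ≃ S), κ ∘ Sum.inl = ι := by
  classical
  refine ⟨_, ((Equiv.ofInjective ι hι).sumCongr (Equiv.refl _)).trans
    (Equiv.Set.sumCompl (Set.range ι)), ?_⟩
  funext s
  simp

open Polynomial in
theorem isEquationallyNoetherian_exactRank {N : ℕ} {j₀ : J} {w v₀ : W j₀} (hv₀ : v₀ ≠ w)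
    {S₀ : Type} {r : ℕ} {a : Fin r → S₀} {c : Fin r → W j₀ → S₀}
    (hac : Flattening.IsAdmissible w a c)
    (h : IsEquationallyNoetherian (rankLE K[X] (shiftShape (W := W) j₀ S₀) N)) :
    IsEquationallyNoetherian (exactRank K W N w a c) := by
  refine h.of_translation (fun F => {G | ∃ (T : FI) (θ : F.1.carrier → S₀ ⊕ T.carrier),
    Function.Injective θ ∧ G = ⟨T, MvPolynomial.eval₂Hom (MvPolynomial.C.comp Polynomial.C)
      (fun v => shiftSubst K w a c v.1 (θ ∘ v.2)) F.2⟩}) ?_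
  rintro M ⟨hM, hvanish, ι, hι, hdet⟩
  obtain ⟨T', κ, rfl⟩ := exists_equiv_sum_of_injective hι
  let x := (Flattening.block (M.y j₀) w (κ ∘ Sum.inl ∘ a) fun m => κ ∘ Sum.inl ∘ c m).det⁻¹
  refine ⟨M.shift j₀ κ x, shift_mem_rankLE j₀ hM κ.injective x,
    fun F => ⟨?_, fun hF σ hσ => ?_⟩⟩
  · rintro hF _ ⟨T, θ, hθ, rfl⟩ σ hσ
    refine (shiftEval_eval₂Hom_shiftSubst κ.injective hv₀ hac hvanish (mul_inv_cancel₀ hdet) hσ θ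
      F.2).trans (hF _ ?_)
    exact κ.injective.comp ((Sum.map_injective.mpr ⟨Function.injective_id, hσ⟩).comp hθ)
  · have := F.1.finite
    let τ : F.1.carrier → S₀ ⊕ T' := κ.symm ∘ σ
    have hτ : Function.Injective τ := κ.symm.injective.comp hσ
    let θ : F.1.carrier → S₀ ⊕ {t // leftPart τ t = none} := glue (leftPart τ) id
    have hfactor : Sum.map id (rightPart τ) ∘ θ = τ :=
      (map_comp_glue _ _ _).trans (glue_leftPart_rightPart τ)
    have hθ : Function.Injective θ := (hfactor.symm ▸ hτ).of_comp
    have hσ_eq : κ ∘ Sum.map id (rightPart τ) ∘ θ = σ := by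
      rw [hfactor]
      exact funext fun t => κ.apply_symm_apply (σ t)
    rw [← hσ_eq, ← shiftEval_eval₂Hom_shiftSubst κ.injective hv₀ hac hvanish (mul_inv_cancel₀ hdet)
      (rightPart_injective hτ) θ F.2]
    exact hF _ ⟨FI.of {t // leftPart τ t = none}, θ, hθ, rfl⟩ _ (rightPart_injective hτ)

open Polynomial in
theorem isEquationallyNoetherian_rankLE_of_shift [∀ j, Finite (W j)] {N : ℕ} {j₀ : J}
    [Nontrivial (W j₀)]
    (h : ∀ (S₀ : Type) [Finite S₀],
      IsEquationallyNoetherian (rankLE K[X] (shiftShape (W := W) j₀ S₀) N)) :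
    IsEquationallyNoetherian (rankLE K W N) := by
  obtain ⟨w, v₀, hwv₀⟩ := exists_pair_ne (W j₀)
  suffices hrank : ∀ r, IsEquationallyNoetherian
      {M | M ∈ rankLE K W N ∧ Flattening.MinorsVanish (M.y j₀) w r} from
    (hrank (N + 1)).mono fun M hM => And.intro hM (hM j₀ w)
  intro r
  induction r with
  | zero => exact .mono (fun M hM => Flattening.not_minorsVanish_zero (M.y j₀) w hM.2) .empty
  | succ r ih =>
    have hexact (s : {s : MinorPattern (W j₀) r // Flattening.IsAdmissible w s.row s.col}) :
        IsEquationallyNoetherian (exactRank K W N w s.1.row s.1.col) :=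
      isEquationallyNoetherian_exactRank hwv₀.symm s.2 (h _)
    refine (ih.union (.iUnion hexact)).mono fun M ⟨hM, hr⟩ => ?_
    by_cases hvanish : Flattening.MinorsVanish (M.y j₀) w r
    · exact Or.inl ⟨hM, hvanish⟩
    unfold Flattening.MinorsVanish at hvanish
    push Not at hvanish
    obtain ⟨a, c, hac, hdet⟩ := hvanish
    obtain ⟨s, ι, hι, rfl, rfl⟩ := MinorPattern.exists_eq_comp a c
    exact Or.inr (Set.mem_iUnion.mpr ⟨⟨s, hac.of_comp⟩, hM, hr, ι, hι, hdet⟩)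

theorem card_maximal_shiftShape_lt [Finite J] [∀ j, Finite (W j)] {d : ℕ}
    (hd : ∀ j, Nat.card (W j) ≤ d) {j₀ : J} (hj₀ : Nat.card (W j₀) = d) (S₀ : Type)
    [Finite S₀] :
    Nat.card {q // Nat.card (shiftShape (W := W) j₀ S₀ q) = d} <
      Nat.card {j // Nat.card (W j) = d} := by
  have hnone (q : {q // Nat.card (shiftShape (W := W) j₀ S₀ q) = d}) (v) :
      q.1.1.2 v = none := by
    by_contra hv
    have hlt := Finite.card_subtype_lt (p := fun v => q.1.1.2 v = none) hv
    exact (hlt.trans_le (hd _)).ne q.2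
  have hcard (q : {q // Nat.card (shiftShape (W := W) j₀ S₀ q) = d}) :
      Nat.card (W q.1.1.1) = d :=
    (hd _).antisymm (q.2.symm.trans_le (Finite.card_subtype_le _))
  let toJ (q : {q // Nat.card (shiftShape (W := W) j₀ S₀ q) = d}) : {j // Nat.card (W j) = d} :=
    ⟨q.1.1.1, hcard q⟩
  have hinj : Function.Injective toJ := by
    rintro ⟨⟨⟨j, p⟩, hp⟩, hq⟩ ⟨⟨⟨j', p'⟩, hp'⟩, hq'⟩ e
    obtain rfl : j = j' := congrArg Subtype.val e
    obtain rfl : p = p' := funext fun v => (hnone ⟨⟨⟨j, p⟩, hp⟩, hq⟩ v).trans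
      (hnone ⟨⟨⟨j, p'⟩, hp'⟩, hq'⟩ v).symm
    rfl
  have hmiss : ⟨j₀, hj₀⟩ ∉ Set.range toJ := by
    rintro ⟨q, hq⟩
    obtain ⟨v, hv⟩ := q.1.2 (congrArg Subtype.val hq)
    simp [hnone q v] at hv
  classical
  have := Fintype.ofFinite {j // Nat.card (W j) = d}
  have := Fintype.ofFinite {q // Nat.card (shiftShape (W := W) j₀ S₀ q) = d}
  simpa only [Nat.card_eq_fintype_card] using Fintype.card_lt_of_injective_of_notMem toJ hinj hmiss

/-- Noetherianity of the rank classes of families of tensors with at most `d` indices each, over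
all Noetherian rings of coefficients. -/
def NoetherianRankClasses (d : ℕ) : Prop :=
  ∀ ⦃K : Type u⦄ [CommRing K] [IsNoetherianRing K] ⦃J : Type⦄ [Finite J] ⦃W : J → Type⦄
    [∀ j, Finite (W j)], (∀ j, Nat.card (W j) ≤ d) → ∀ N, IsEquationallyNoetherian (rankLE K W N)

theorem NoetherianRankClasses.succ {d : ℕ} (hd : 1 ≤ d) (h : NoetherianRankClasses.{u} d) :
    NoetherianRankClasses.{u} (d + 1) := by
  intro K _ _ J _ W _ hW N
  induction hn : Nat.card {j // Nat.card (W j) = d + 1} using Nat.strong_induction_on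
    generalizing K J with
  | _ n ih =>
    subst hn
    by_cases hmax : ∃ j₀, Nat.card (W j₀) = d + 1
    · obtain ⟨j₀, hj₀⟩ := hmax
      have : Nontrivial (W j₀) := Finite.one_lt_card_iff_nontrivial.mp (by omega)
      exact isEquationallyNoetherian_rankLE_of_shift fun S₀ _ =>
        ih _ (card_maximal_shiftShape_lt hW hj₀ S₀)
          (fun q => (Finite.card_subtype_le _).trans (hW _)) rfl
    · push Not at hmax
      exact h (fun j => Nat.le_of_lt_succ ((hW j).lt_of_ne (hmax j))) N

end TensorPoint

/-! ### Leading coefficient ideals -/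

section LeadingCoefficients

open scoped MonomialOrder

open MvPolynomial

variable {σ τ R : Type*} [CommRing R] (m : MonomialOrder σ)

/-- The ideal of coefficients of the monomial `u` in those elements of `I` whose leading monomial
is at most `u`. -/
def leadingCoeffIdeal (I : Ideal (MvPolynomial σ R)) (u : σ →₀ ℕ) : Ideal R where
  carrier := {c | ∃ f ∈ I, m.degree f ≼[m] u ∧ f.coeff u = c}
  zero_mem' := ⟨0, I.zero_mem, by simp⟩
  add_mem' := by
    rintro _ _ ⟨f, hf, hfu, rfl⟩ ⟨g, hg, hgu, rfl⟩
    exact ⟨f + g, I.add_mem hf hg, m.degree_add_le.trans (sup_le hfu hgu), coeff_add u f g⟩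
  smul_mem' := by
    rintro a _ ⟨f, hf, hfu, rfl⟩
    exact ⟨a • f, I.smul_of_tower_mem a hf, m.degree_smul_le.trans hfu, coeff_smul u a f⟩

variable {m} in
theorem leadingCoeffIdeal_mono {I I' : Ideal (MvPolynomial σ R)} (h : I ≤ I') (u : σ →₀ ℕ) :
    leadingCoeffIdeal m I u ≤ leadingCoeffIdeal m I' u :=
  fun _ ⟨f, hf, hfu⟩ => ⟨f, h hf, hfu⟩

theorem le_of_leadingCoeffIdeal_le {I I' : Ideal (MvPolynomial σ R)} (hle : I' ≤ I)
    (h : ∀ u, leadingCoeffIdeal m I u ≤ leadingCoeffIdeal m I' u) : I ≤ I' := by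
  intro f hf
  induction hd : m.toSyn (m.degree f) using WellFoundedLT.induction generalizing f with
  | ind d ih =>
    subst hd
    obtain ⟨g, hg, hgd, hcoeff⟩ := h (m.degree f) ⟨f, hf, le_rfl, rfl⟩
    suffices hsub : f - g ∈ I' from by simpa using I'.add_mem hsub hg
    have hle_degree : m.degree (f - g) ≼[m] m.degree f := m.degree_sub_le.trans (sup_le le_rfl hgd)
    have hcancel : (f - g).coeff (m.degree f) = 0 := by rw [coeff_sub, hcoeff, sub_self]
    rcases hle_degree.lt_or_eq with hlt | heq
    · exact ih _ hlt (I.sub_mem hf (hle hg)) rfl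
    · rw [← m.toSyn.injective heq, m.coeff_degree_eq_zero_iff] at hcancel
      exact hcancel ▸ I'.zero_mem

variable {m} in
theorem leadingCoeffIdeal_le_of_mapDomain_le {m' : MonomialOrder τ}
    {I : Ideal (MvPolynomial σ R)} {I' : Ideal (MvPolynomial τ R)} {g : σ → τ}
    (hg : Function.Injective g)
    (hmono : ∀ u v : σ →₀ ℕ, u ≼[m] v → u.mapDomain g ≼[m'] v.mapDomain g)
    (h : ∀ p ∈ I, rename g p ∈ I') {u : σ →₀ ℕ} {v : τ →₀ ℕ} (huv : u.mapDomain g ≤ v) :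
    leadingCoeffIdeal m I u ≤ leadingCoeffIdeal m' I' v := by
  classical
  rintro _ ⟨p, hp, hpu, rfl⟩
  obtain ⟨s, rfl⟩ := exists_add_of_le huv
  have hrename : m'.degree (rename g p) ≼[m'] u.mapDomain g := by
    rw [m'.degree_le_iff]
    intro v hv
    rw [support_rename_of_injective hg] at hv
    obtain ⟨u', hu', rfl⟩ := Finset.mem_image.mp hv
    exact hmono u' u ((m.le_degree hu').trans hpu)
  refine ⟨rename g p * monomial s 1, I'.mul_mem_right _ (h p hp), ?_, ?_⟩
  · refine m'.degree_mul_le.trans ?_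
    rw [map_add, map_add]
    exact add_le_add hrename (m'.degree_monomial_le 1)
  · rw [coeff_mul_monomial, coeff_rename_mapDomain g hg, mul_one]

theorem mapDomain_lex_le [LinearOrder σ] [WellFoundedGT σ] [LinearOrder τ] [WellFoundedGT τ]
    {g : σ → τ} (hg : StrictMono g) (u v : σ →₀ ℕ) (h : u ≼[MonomialOrder.lex] v) :
    u.mapDomain g ≼[MonomialOrder.lex] v.mapDomain g := by
  rcases h.lt_or_eq with hlt | heq
  · obtain ⟨i, hi, hlt⟩ := Finsupp.Lex.lt_iff.mp hlt
    refine (Finsupp.Lex.lt_iff.mpr ⟨g i, fun j hj => ?_, ?_⟩).le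
    · by_cases hjr : j ∈ Set.range g
      · obtain ⟨j, rfl⟩ := hjr
        exact (Finsupp.mapDomain_apply hg.injective u j).trans
          ((hi j (hg.lt_iff_lt.mp hj)).trans (Finsupp.mapDomain_apply hg.injective v j).symm)
      · exact (Finsupp.mapDomain_of_notMem_range u j hjr).trans
          (Finsupp.mapDomain_of_notMem_range v j hjr).symm
    · exact (Finsupp.mapDomain_apply hg.injective u i).trans_lt
        (hlt.trans_eq (Finsupp.mapDomain_apply hg.injective v i).symm)
  · rw [MonomialOrder.lex.toSyn.injective heq]

end LeadingCoefficients

/-! ### Cohen's theorem on polynomial rings in rows of variables -/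

/-- The variables in `n` rows indexed by `α`, ordered row by row. -/
abbrev RowVar (α : Type*) (n : ℕ) := Fin n ×ₗ α

/-- The monomials in any number of rows of variables. -/
abbrev RowMonomial (α : Type*) := Σ n, (RowVar α n →₀ ℕ)

namespace RowVar

variable {α : Type*} {m n : ℕ}

instance [Finite α] : Finite (RowVar α n) := inferInstanceAs (Finite (Fin n × α))

/-- The map of variables that maps rows by `o`. -/
def map (o : Fin m → Fin n) (p : RowVar α m) : RowVar α n :=
  toLex (o (ofLex p).1, (ofLex p).2)

theorem map_strictMono [LinearOrder α] {o : Fin m → Fin n} (ho : StrictMono o) :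
    StrictMono (map (α := α) o) := by
  intro p q h
  rw [Prod.Lex.lt_iff] at h ⊢
  exact h.imp (@ho _ _) (And.imp_left (congrArg o))

theorem map_injective {o : Fin m → Fin n} (ho : Function.Injective o) :
    Function.Injective (map (α := α) o) :=
  ho.prodMap Function.injective_id

end RowVar

namespace RowMonomial

variable {α : Type*}

/-- Divisibility of monomials up to increasing maps of rows. -/
def Divides (u v : RowMonomial α) : Prop :=
  ∃ o : Fin u.1 ↪o Fin v.1, u.2.mapDomain (RowVar.map o) ≤ v.2

/-- The exponents of a monomial as a word whose letters are the rows. -/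
def rows (u : RowMonomial α) : List (α → ℕ) := List.ofFn fun i a => u.2 (toLex (i, a))

theorem divides_of_sublistForall₂ {u v : RowMonomial α}
    (h : List.SublistForall₂ (· ≤ ·) u.rows v.rows) : Divides u v := by
  obtain ⟨l, hl, hsub⟩ := List.sublistForall₂_iff.mp h
  obtain ⟨o, ho⟩ := List.sublist_iff_exists_fin_orderEmbedding_get_eq.mp hsub
  have hlen : l.length = u.1 := by simpa [rows] using hl.length_eq.symm
  let o' : Fin u.1 ↪o Fin v.1 :=
    ((Fin.castOrderIso hlen.symm).toOrderEmbedding.trans o).trans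
      (Fin.castOrderIso (by simp [rows])).toOrderEmbedding
  have hle : ∀ i a, u.2 (toLex (i, a)) ≤ v.2 (toLex (o' i, a)) := by
    intro i a
    have hrow := hl.get (i := i) (by simp [rows]) (by rw [hlen]; exact i.2)
    have hget := ho ⟨i, by rw [hlen]; exact i.2⟩
    simp only [List.get_eq_getElem] at hrow hget
    rw [hget] at hrow
    simp only [rows, List.getElem_ofFn] at hrow
    exact hrow a
  refine ⟨o', fun p => ?_⟩
  by_cases hp : p ∈ Set.range (RowVar.map o')
  · obtain ⟨q, rfl⟩ := hp
    rw [Finsupp.mapDomain_apply (RowVar.map_injective o'.injective)]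
    exact hle (ofLex q).1 (ofLex q).2
  · rw [Finsupp.mapDomain_of_notMem_range _ _ hp]
    exact Nat.zero_le _

theorem exists_divides_subseq [Finite α] (u : ℕ → RowMonomial α) :
    ∃ g : ℕ ↪o ℕ, ∀ m n, m ≤ n → Divides (u (g m)) (u (g n)) := by
  have higman := Set.PartiallyWellOrderedOn.partiallyWellOrderedOn_sublistForall₂
    (α := α → ℕ) (· ≤ ·) (Set.partiallyWellOrderedOn_of_wellQuasiOrdered
      wellQuasiOrdered_le Set.univ)
  have : IsPreorder (List (α → ℕ)) (List.SublistForall₂ (· ≤ ·)) :=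
    { refl := Std.Refl.refl, trans := fun _ _ _ => _root_.trans }
  obtain ⟨g, hg⟩ := higman.exists_monotone_subseq (f := fun n => (u n).rows) (by simp)
  exact ⟨g, fun m n hmn => divides_of_sublistForall₂ (hg m n hmn)⟩

end RowMonomial

/-- A family of ideals in the polynomial rings in rows of variables that is preserved by
increasing maps of rows. -/
structure RowIdeal (α R : Type*) [CommRing R] where
  obj : ∀ n, Ideal (MvPolynomial (RowVar α n) R)
  map_mem : ∀ {m n} (o : Fin m → Fin n), StrictMono o → ∀ p ∈ obj m,
    MvPolynomial.rename (RowVar.map o) p ∈ obj n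

namespace RowIdeal

variable {α R : Type*} [CommRing R]

/-- The ideal of leading coefficients of `I` at the monomial `u`, for the lexicographic order. -/
noncomputable def leadingCoeffs [LinearOrder α] [Finite α] (I : RowIdeal α R) (u : RowMonomial α) :
    Ideal R :=
  leadingCoeffIdeal MonomialOrder.lex (I.obj u.1) u.2

theorem leadingCoeffs_mono [LinearOrder α] [Finite α] (I : RowIdeal α R) {u v : RowMonomial α}
    (h : u.Divides v) : I.leadingCoeffs u ≤ I.leadingCoeffs v := by
  obtain ⟨o, ho⟩ := h
  have hmap := RowVar.map_strictMono (α := α) o.strictMono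
  exact leadingCoeffIdeal_le_of_mapDomain_le hmap.injective (mapDomain_lex_le hmap)
    (I.map_mem o o.strictMono) ho

theorem exists_finset_leadingCoeffs_le [LinearOrder α] [Finite α] [IsNoetherianRing R]
    (I : RowIdeal α R) :
    ∃ U : Finset (RowMonomial α), ∀ v, ∃ u ∈ U, u.Divides v ∧
      I.leadingCoeffs v ≤ I.leadingCoeffs u := by
  by_contra! hcon
  obtain ⟨f, -, hf⟩ := exists_seq_of_forall_finset_exists (fun _ => True)
    (fun u v => u.Divides v → ¬ I.leadingCoeffs v ≤ I.leadingCoeffs u)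
    (fun s _ => (hcon s).imp fun _ hv => ⟨trivial, hv⟩)
  obtain ⟨g, hg⟩ := RowMonomial.exists_divides_subseq f
  obtain ⟨n, hn⟩ := monotone_stabilizes_iff_noetherian.mpr (inferInstance : IsNoetherian R R)
    ⟨fun n => I.leadingCoeffs (f (g n)), fun m n hmn => I.leadingCoeffs_mono (hg m n hmn)⟩
  exact hf _ _ (g.strictMono n.lt_succ_self) (hg _ _ n.le_succ) (hn (n + 1) n.le_succ).ge

/-- The family of ideals generated by the images of the elements of `E` under injections of
rows. -/
noncomputable def span (E : Set (Σ n, MvPolynomial (RowVar α n) R)) : RowIdeal α R where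
  obj n := Ideal.span {p | ∃ q ∈ E, ∃ o : Fin q.1 → Fin n, Function.Injective o ∧
    MvPolynomial.rename (RowVar.map o) q.2 = p}
  map_mem o ho p hp := by
    refine Ideal.mem_comap.mp (Ideal.span_le.mpr ?_ hp)
    rintro _ ⟨q, hq, o', ho', rfl⟩
    exact Ideal.subset_span ⟨q, hq, o ∘ o', ho.injective.comp ho',
      (MvPolynomial.rename_rename (RowVar.map o') (RowVar.map o) q.2).symm⟩

theorem span_mono {E E' : Set (Σ n, MvPolynomial (RowVar α n) R)} (h : E ⊆ E') (n : ℕ) :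
    (span E).obj n ≤ (span E').obj n :=
  Ideal.span_mono fun _ ⟨q, hq, hq'⟩ => ⟨q, h hq, hq'⟩

theorem exists_finite_mem_span {E : Set (Σ n, MvPolynomial (RowVar α n) R)} {n : ℕ}
    {p : MvPolynomial (RowVar α n) R} (hp : p ∈ (span E).obj n) :
    ∃ E₀ ⊆ E, E₀.Finite ∧ p ∈ (span E₀).obj n := by
  obtain ⟨G, hG, hp⟩ := Submodule.mem_span_finite_of_mem_span hp
  choose q hq hqG using fun g : G => hG g.2
  refine ⟨Set.range q, Set.range_subset_iff.mpr hq, Set.finite_range q,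
    Submodule.span_mono (fun g hg => ?_) hp⟩
  exact ⟨q ⟨g, hg⟩, Set.mem_range_self _, hqG ⟨g, hg⟩⟩

theorem exists_finite_leadingCoeffs_span_le [LinearOrder α] [Finite α] [IsNoetherianRing R]
    (E : Set (Σ n, MvPolynomial (RowVar α n) R)) (u : RowMonomial α) :
    ∃ E₀ ⊆ E, E₀.Finite ∧ (span E).leadingCoeffs u ≤ (span E₀).leadingCoeffs u := by
  obtain ⟨_, ⟨E₀, hsub, hfin, rfl⟩, hmax⟩ := set_has_maximal_iff_noetherian.mpr
    (inferInstance : IsNoetherian R R)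
    {I | ∃ E₀ ⊆ E, E₀.Finite ∧ I = (span E₀).leadingCoeffs u}
    ⟨_, ∅, Set.empty_subset E, Set.finite_empty, rfl⟩
  refine ⟨E₀, hsub, hfin, ?_⟩
  rintro _ ⟨p, hp, hpu, rfl⟩
  obtain ⟨E₁, hsub₁, hfin₁, hp⟩ := exists_finite_mem_span hp
  have heq : (span E₀).leadingCoeffs u = (span (E₀ ∪ E₁)).leadingCoeffs u :=
    (leadingCoeffIdeal_mono (span_mono Set.subset_union_left u.1) u.2).eq_of_not_lt
      (hmax _ ⟨_, Set.union_subset hsub hsub₁, hfin.union hfin₁, rfl⟩)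
  exact heq ▸ ⟨p, span_mono Set.subset_union_right u.1 hp, hpu, rfl⟩

theorem exists_finite_span_le [Finite α] [IsNoetherianRing R]
    (E : Set (Σ n, MvPolynomial (RowVar α n) R)) :
    ∃ E₀ ⊆ E, E₀.Finite ∧ ∀ n, (span E).obj n ≤ (span E₀).obj n := by
  let _ : LinearOrder α := LinearOrder.lift' (Finite.equivFin α) (Finite.equivFin α).injective
  obtain ⟨U, hU⟩ := exists_finset_leadingCoeffs_le (span E)
  choose E₀ hsub hfin hle using exists_finite_leadingCoeffs_span_le E
  refine ⟨⋃ u ∈ U, E₀ u, Set.iUnion₂_subset fun u _ => hsub u,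
    U.finite_toSet.biUnion fun u _ => hfin u, fun n => ?_⟩
  refine le_of_leadingCoeffIdeal_le MonomialOrder.lex
    (span_mono (Set.iUnion₂_subset fun u _ => hsub u) n) fun v => ?_
  obtain ⟨u, hu, hdiv, hvu⟩ := hU ⟨n, v⟩
  calc leadingCoeffIdeal MonomialOrder.lex ((span E).obj n) v
      ≤ (span E).leadingCoeffs u := hvu
    _ ≤ (span (E₀ u)).leadingCoeffs u := hle u
    _ ≤ (span (⋃ u ∈ U, E₀ u)).leadingCoeffs u :=
      leadingCoeffIdeal_mono (span_mono (Set.subset_biUnion_of_mem (u := E₀) hu) u.1) u.2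
    _ ≤ (span (⋃ u ∈ U, E₀ u)).leadingCoeffs ⟨n, v⟩ := leadingCoeffs_mono _ hdiv

end RowIdeal

/-! ### Equational Noetherianity of tensors of bounded rank -/

namespace TensorPoint

section Rows

variable {K : Type u} [CommRing K] {J : Type} {W : J → Type}

variable (K W) in
open scoped Classical in
/-- Polynomials in the entries of tensors with at most one index as polynomials in rows of
variables, over a ring that contains the entries of the tensors without indices. -/
noncomputable def toRow {T : Type} {n : ℕ} (e : T → Fin n) :
    MvPolynomial (TensorVar W T) K →+* MvPolynomial (RowVar J n) (MvPolynomial J K) :=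
  MvPolynomial.eval₂Hom (MvPolynomial.C.comp MvPolynomial.C) fun v =>
    if h : Nonempty (W v.1) then MvPolynomial.X (toLex (e (v.2 h.some), v.1))
    else MvPolynomial.C (MvPolynomial.X v.1)

open scoped Classical in
/-- Evaluation of polynomials in rows of variables at a family of tensors with at most one
index. -/
noncomputable def rowEval (M : TensorPoint K W) {n : ℕ} (σ : Fin n → M.S) :
    MvPolynomial (RowVar J n) (MvPolynomial J K) →+* M.Ω :=
  MvPolynomial.eval₂Hom
    (MvPolynomial.eval₂Hom M.coeff fun j =>
      if h : Nonempty (W j) then 0 else M.y j fun w => (h ⟨w⟩).elim)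
    fun p => M.y (ofLex p).2 fun _ => σ (ofLex p).1

theorem rowEval_rename (M : TensorPoint K W) {m n : ℕ} (σ : Fin n → M.S) (o : Fin m → Fin n)
    (p : MvPolynomial (RowVar J m) (MvPolynomial J K)) :
    M.rowEval σ (MvPolynomial.rename (RowVar.map o) p) = M.rowEval (σ ∘ o) p :=
  MvPolynomial.eval₂Hom_rename _ _ _ _

theorem rowEval_toRow [∀ j, Subsingleton (W j)] (M : TensorPoint K W) {T : Type} {n : ℕ}
    (e : T → Fin n) (σ : Fin n → M.S) (F : MvPolynomial (TensorVar W T) K) :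
    M.rowEval σ (toRow K W e F) = M.eval (σ ∘ e) F := by
  suffices hcomp : (M.rowEval σ).comp (toRow K W e) = M.eval (σ ∘ e) from DFunLike.congr_fun hcomp F
  refine MvPolynomial.ringHom_ext (fun c => by simp [toRow, rowEval, eval]) fun ⟨j, f⟩ => ?_
  by_cases h : Nonempty (W j)
  · simp only [toRow, rowEval, eval, RingHom.comp_apply, MvPolynomial.eval₂Hom_X', dif_pos h,
      ofLex_toLex]
    exact congrArg (M.y j) (funext fun w => congrArg (σ ∘ e ∘ f) (Subsingleton.elim _ w))
  · simp only [toRow, rowEval, eval, RingHom.comp_apply, MvPolynomial.eval₂Hom_X', dif_neg h,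
      MvPolynomial.eval₂Hom_C]
    exact congrArg (M.y j) (funext fun w => (h ⟨w⟩).elim)

theorem isEquationallyNoetherian_univ [IsNoetherianRing K] [Finite J] [∀ j, Subsingleton (W j)] :
    IsEquationallyNoetherian (Set.univ : Set (TensorPoint K W)) := by
  intro E
  let e (F : TensorEquation K W) := Finite.equivFin F.1.carrier
  let toRows (F : TensorEquation K W) : Σ n, MvPolynomial (RowVar J n) (MvPolynomial J K) :=
    ⟨Nat.card F.1.carrier, toRow K W (e F) F.2⟩
  obtain ⟨E₀, hsub, hfin, hE⟩ := Set.exists_subset_image_finite_and.mp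
    (RowIdeal.exists_finite_span_le (toRows '' E))
  refine ⟨E₀, hsub, hfin, fun M _ hM F hF σ hσ => ?_⟩
  have hσe : (σ ∘ (e F).symm) ∘ e F = σ := funext fun t => congrArg σ ((e F).symm_apply_apply t)
  have hmem : (toRows F).2 ∈ (RowIdeal.span (toRows '' E)).obj (toRows F).1 :=
    Ideal.subset_span ⟨toRows F, ⟨F, hF, rfl⟩, id, Function.injective_id,
      MvPolynomial.rename_id_apply _⟩
  have hker : (RowIdeal.span (toRows '' E₀)).obj (toRows F).1 ≤
      RingHom.ker (M.rowEval (σ ∘ (e F).symm)) := by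
    refine Ideal.span_le.mpr ?_
    rintro _ ⟨_, ⟨G, hG, rfl⟩, o, ho, rfl⟩
    rw [SetLike.mem_coe, RingHom.mem_ker, rowEval_rename]
    exact (rowEval_toRow M _ _ _).trans
      (hM G hG _ (((hσ.comp (e F).symm.injective).comp ho).comp (e G).injective))
  rw [← hσe, ← rowEval_toRow]
  exact hker (hE _ hmem)

end Rows

theorem NoetherianRankClasses.one : NoetherianRankClasses.{u} 1 := by
  intro K _ _ J _ W _ hW N
  have (j : J) : Subsingleton (W j) := Finite.card_le_one_iff_subsingleton.mp (hW j)
  exact isEquationallyNoetherian_univ.mono (Set.subset_univ _)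

theorem isEquationallyNoetherian_rankLE {K : Type u} [CommRing K] [IsNoetherianRing K] {J : Type}
    [Finite J] {W : J → Type} [∀ j, Finite (W j)] (N : ℕ) :
    IsEquationallyNoetherian (rankLE K W N) := by
  obtain ⟨d, hd⟩ := (Set.finite_range fun j => Nat.card (W j)).bddAbove
  have hclass : NoetherianRankClasses.{u} (max 1 d) :=
    Nat.le_induction .one (fun _ h => .succ h) _ (le_max_left 1 d)
  exact hclass (fun j => (hd (Set.mem_range_self j)).trans (le_max_right 1 d)) N

end TensorPoint

/-! ### FI-algebras generated in width at most one -/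

theorem det_mul_eq_zero_of_card_lt {R m n : Type*} [CommRing R] [Fintype m] [DecidableEq m]
    [Fintype n] (P : Matrix m n R) (Q : Matrix n m R) (h : Fintype.card n < Fintype.card m) :
    (P * Q).det = 0 := by
  classical
  rw [Matrix.det_eq_sign_charpoly_coeff, Matrix.charpoly_mul_comm_of_le P Q h.le,
    Polynomial.mul_coeff_zero, Polynomial.coeff_X_pow, if_neg (Nat.sub_pos_of_lt h).ne, zero_mul,
    mul_zero]

namespace FIAlgebra

section Width

variable {K : Type u} [CommRing K] {A B : FIAlgebra K}

theorem map_map_apply (A : FIAlgebra K) {S T R : FI} (f : S ⟶ T) (g : T ⟶ R) (a : A.obj S) :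
    (A.map g).hom ((A.map f).hom a) = (A.map (f ≫ g)).hom a := by
  rw [A.map_comp]
  rfl

theorem map_id_apply (A : FIAlgebra K) {S : FI} (a : A.obj S) : (A.map (𝟙 S)).hom a = a := by
  rw [A.map_id]
  rfl

theorem IsGeneratedInWidthLE.adjoin_eq_top {d : ℕ} (hA : A.IsGeneratedInWidthLE d) (S : FI) :
    Algebra.adjoin K {x : A.obj S | ∃ n ≤ d, ∃ (π : FI.fin n ⟶ S) (a : A.obj (FI.fin n)),
      (A.map π).hom a = x} = ⊤ := by
  obtain ⟨D, hD, hgen⟩ := hA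
  refine hgen
    { obj := fun S => Algebra.adjoin K {x : A.obj S | ∃ n ≤ d, ∃ (π : FI.fin n ⟶ S)
        (a : A.obj (FI.fin n)), (A.map π).hom a = x}
      map_mem := fun {S T} f a ha => ?_ } (fun x hx => ?_) S
  · refine Subalgebra.mem_comap _ (A.map f).hom a |>.mp (Algebra.adjoin_le ?_ ha)
    rintro _ ⟨n, hn, π, a, rfl⟩
    exact Algebra.subset_adjoin ⟨n, hn, π ≫ f, a, (map_map_apply A π f a).symm⟩
  · exact Algebra.subset_adjoin ⟨A.width x, hD x hx, Nat.sInf_mem (A.width_set_nonempty x)⟩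

/-- The inclusion of a subset of a finite set. -/
def inclusion {S : FI} (P : S.carrier → Prop) : FI.of {s // P s} ⟶ S :=
  Function.Embedding.subtype P

theorem map_mem_range_inclusion {S T : FI} {P : S.carrier → Prop} (π : T ⟶ S)
    (h : ∀ t, P (π.1 t)) (a : A.obj T) : (A.map π).hom a ∈ (A.map (inclusion P)).hom.range := by
  let π' : T ⟶ FI.of {s // P s} := ⟨fun t => ⟨π.1 t, h t⟩, fun t t' e =>
    π.2 (congrArg Subtype.val e)⟩
  exact ⟨(A.map π').hom a, map_map_apply A π' (inclusion P) a⟩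

theorem IsGeneratedInWidthLE.range_sup_range_eq_top (hA : A.IsGeneratedInWidthLE 1) {S : FI}
    (P : S.carrier → Prop) :
    (A.map (inclusion P)).hom.range ⊔ (A.map (inclusion fun s => ¬ P s)).hom.range = ⊤ := by
  rw [← top_le_iff, ← hA.adjoin_eq_top S]
  refine Algebra.adjoin_le ?_
  rintro _ ⟨n, hn, π, a, rfl⟩
  have : Subsingleton (Fin n) := Fin.subsingleton_iff_le_one.mpr hn
  by_cases h : ∀ i, ¬ P (π.1 i)
  · exact SetLike.le_def.mp le_sup_right (map_mem_range_inclusion π h a)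
  · obtain ⟨i, hi⟩ := not_forall_not.mp h
    refine SetLike.le_def.mp le_sup_left (map_mem_range_inclusion π (fun j => ?_) a)
    exact (Subsingleton.elim (α := Fin n) i j) ▸ hi

theorem IsGeneratedInWidthLE.exists_eq_sum (hA : A.IsGeneratedInWidthLE 1) {S : FI}
    (P : S.carrier → Prop) (g : A.obj S) :
    ∃ (n : ℕ) (u : Fin n → A.obj (FI.of {s // P s})) (v : Fin n → A.obj (FI.of {s // ¬ P s})),
      g = ∑ k, (A.map (inclusion P)).hom (u k) * (A.map (inclusion fun s => ¬ P s)).hom (v k) := by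
  have hg : g ∈ (⊤ : Subalgebra K (A.obj S)) := trivial
  rw [← hA.range_sup_range_eq_top P, ← Subalgebra.mem_toSubmodule,
    ← Subalgebra.mul_toSubmodule] at hg
  induction hg using Submodule.mul_induction_on' with
  | mem_mul_mem x hx y hy =>
    obtain ⟨x, rfl⟩ := hx
    obtain ⟨y, rfl⟩ := hy
    exact ⟨1, fun _ => x, fun _ => y, by simp⟩
  | add x _ y _ hx hy =>
    obtain ⟨n, u, v, rfl⟩ := hx
    obtain ⟨n', u', v', rfl⟩ := hy
    exact ⟨n + n', Fin.append u u', Fin.append v v', by simp [Fin.sum_univ_add]⟩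

open scoped Classical in
/-- The entry at the index `f` of the tensor of all images of `x`: the image of `x` under `f`, or
zero if `f` is not injective. -/
noncomputable def translate (x : A.Element) (T : FI) (f : x.1.carrier → T.carrier) : A.obj T :=
  if h : Function.Injective f then (A.map (X := x.1) (Y := T) ⟨f, h⟩).hom x.2 else 0

theorem translate_of_injective {x : A.Element} {T : FI} {f : x.1.carrier → T.carrier}
    (h : Function.Injective f) :
    translate x T f = (A.map (X := x.1) (Y := T) ⟨f, h⟩).hom x.2 :=
  dif_pos h

theorem translate_of_not_injective {x : A.Element} {T : FI} {f : x.1.carrier → T.carrier}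
    (h : ¬ Function.Injective f) : translate x T f = 0 :=
  dif_neg h

theorem map_translate (x : A.Element) {S T : FI} (g : S ⟶ T) (f : x.1.carrier → S.carrier) :
    (A.map g).hom (translate x S f) = translate x T (g.1 ∘ f) := by
  by_cases h : Function.Injective f
  · rw [translate_of_injective h, translate_of_injective (g.2.comp h), map_map_apply]
    rfl
  · rw [translate_of_not_injective h, translate_of_not_injective fun h' => h h'.of_comp, map_zero]

/-- The image of an element of `B` under a morphism of FI-algebras. -/
abbrev mapElement (φ : B ⟶ A) (x : B.Element) : A.Element := ⟨x.1, (φ.app x.1).hom x.2⟩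

theorem app_translate (φ : B ⟶ A) (x : B.Element) (T : FI) (f : x.1.carrier → T.carrier) :
    (φ.app T).hom (translate x T f) = translate (mapElement φ x) T f := by
  by_cases h : Function.Injective f
  · rw [translate_of_injective h, ← CommAlgCat.comp_apply, φ.naturality, CommAlgCat.comp_apply]
    exact (translate_of_injective (x := mapElement φ x) h).symm
  · rw [translate_of_not_injective h, map_zero]
    exact (translate_of_not_injective (x := mapElement φ x) h).symm

theorem IsGeneratedInWidthLE.exists_minorsVanish_translate (hA : A.IsGeneratedInWidthLE 1)
    (x : A.Element) (w : x.1.carrier) :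
    ∃ n, ∀ (T : FI) (r : ℕ), n < r → Flattening.MinorsVanish (translate x T) w r := by
  classical
  obtain ⟨n, u, v, huv⟩ := hA.exists_eq_sum (fun s => s = w) x.2
  refine ⟨n, fun T r hr a c hac => ?_⟩
  let α (i : Fin r) : FI.of {s // s = w} ⟶ T :=
    ⟨fun _ => a i, fun s s' _ => Subtype.ext (s.2.trans s'.2.symm)⟩
  let β (m : Fin r) : FI.of {s // ¬ s = w} ⟶ T := ⟨fun s => c m s.1, fun s s' e =>
    Subtype.ext ((injective_update_iff.mp (hac m m)).1 s.1 s'.1 s.2 s'.2 e)⟩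
  have hfactor : Flattening.block (translate x T) w a c =
      (Matrix.of fun i k => (A.map (α i)).hom (u k)) *
        Matrix.of fun k m => (A.map (β m)).hom (v k) := by
    ext i m
    let f : x.1 ⟶ T := ⟨Function.update (c m) w (a i), hac i m⟩
    have hα : inclusion (fun s => s = w) ≫ f = α i := by
      apply Function.Embedding.ext
      rintro ⟨s, rfl⟩
      exact Function.update_self s (a i) (c m)
    have hβ : inclusion (fun s => ¬ s = w) ≫ f = β m := by
      apply Function.Embedding.ext
      rintro ⟨s, hs⟩
      exact Function.update_of_ne hs (a i) (c m)
    calc translate x T (Function.update (c m) w (a i)) = (A.map f).hom x.2 :=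
          translate_of_injective (hac i m)
      _ = ∑ k, (A.map (α i)).hom (u k) * (A.map (β m)).hom (v k) := by
          rw [huv, map_sum]
          simp only [map_mul, map_map_apply, hα, hβ]
  rw [hfactor]
  exact det_mul_eq_zero_of_card_lt _ _ (by simpa using hr)

end Width

/-! ### Primes of FI-algebras as families of tensors -/

section Tensors

variable {K : Type u} [CommRing K] {B : FIAlgebra K}

/-- On the subsets `Y S` of `Spec B(S)`, every system of elements of `B` has the same zeros as a
finite subsystem. -/
def IsNoetherianOn (B : FIAlgebra K) (Y : ∀ S : FI, Set (B.spec.at_ S)) : Prop :=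
  ∀ E : Set B.Element, ∃ E₀ ⊆ E, E₀.Finite ∧ ∀ S, Y S ∩ B.zeroLocus E₀ S ⊆ B.zeroLocus E S

theorem IsNoetherianOn.mono {Y Y' : ∀ S : FI, Set (B.spec.at_ S)} (h : ∀ S, Y S ⊆ Y' S)
    (hY' : B.IsNoetherianOn Y') : B.IsNoetherianOn Y := by
  intro E
  obtain ⟨E₀, hsub, hfin, hE⟩ := hY' E
  exact ⟨E₀, hsub, hfin, fun S => (Set.inter_subset_inter_left _ (h S)).trans (hE S)⟩

variable {J : Type} (d : J → B.Element)

/-- The shapes of the tensors formed by the images of the elements `d`. -/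
abbrev tensorShape (j : J) : Type := (d j).1.carrier

/-- The homomorphism that substitutes the images of the elements `d` for the entries of the
tensors. -/
noncomputable def polyMap (T : FI) :
    MvPolynomial (TensorVar (tensorShape d) T.carrier) K →ₐ[K] B.obj T :=
  MvPolynomial.aeval fun v => translate (d v.1) T v.2

theorem map_polyMap {S T : FI} (f : S ⟶ T)
    (F : MvPolynomial (TensorVar (tensorShape d) S.carrier) K) :
    (B.map f).hom (polyMap d S F) =
      MvPolynomial.aeval (fun v => translate (d v.1) T (f.1 ∘ v.2)) F := by
  rw [polyMap, ← AlgHom.comp_apply, MvPolynomial.comp_aeval]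
  simp only [map_translate]

theorem polyMap_surjective (hd : B.IsGeneratedBy (Set.range d)) (T : FI) :
    Function.Surjective (polyMap d T) := by
  rw [← AlgHom.range_eq_top]
  refine hd { obj := fun T => (polyMap d T).range, map_mem := ?_ } ?_ T
  · rintro S T f _ ⟨F, rfl⟩
    refine ⟨MvPolynomial.rename (fun v => ⟨v.1, f.1 ∘ v.2⟩) F, ?_⟩
    exact (MvPolynomial.aeval_rename _ _ _).trans (map_polyMap d f F).symm
  · rintro _ ⟨j, rfl⟩
    refine ⟨MvPolynomial.X ⟨j, id⟩, (MvPolynomial.aeval_X _ _).trans ?_⟩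
    rw [translate_of_injective Function.injective_id]
    exact map_id_apply B (d j).2

/-- The family of tensors over the residue field of a prime that is formed by the images of the
elements `d`. -/
noncomputable def tensorPoint {S : FI} (p : PrimeSpectrum (B.obj S)) :
    TensorPoint K (tensorShape d) where
  S := S.carrier
  Ω := p.asIdeal.ResidueField
  coeff := (algebraMap (B.obj S) p.asIdeal.ResidueField).comp (algebraMap K (B.obj S))
  y j f := algebraMap (B.obj S) p.asIdeal.ResidueField (translate (d j) S f)
  y_eq_zero j f hf := by rw [translate_of_not_injective hf, map_zero]

theorem eval_tensorPoint {S T : FI} (p : PrimeSpectrum (B.obj S)) (σ : T ⟶ S)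
    (F : MvPolynomial (TensorVar (tensorShape d) T.carrier) K) :
    (tensorPoint d p).eval σ.1 F =
      algebraMap (B.obj S) p.asIdeal.ResidueField ((B.map σ).hom (polyMap d T F)) := by
  rw [map_polyMap, MvPolynomial.aeval_def, MvPolynomial.hom_eval₂]
  rfl

theorem eval_tensorPoint_eq_zero_iff {S T : FI} (p : PrimeSpectrum (B.obj S)) (σ : T ⟶ S)
    (F : MvPolynomial (TensorVar (tensorShape d) T.carrier) K) :
    (tensorPoint d p).eval σ.1 F = 0 ↔ (B.map σ).hom (polyMap d T F) ∈ p.asIdeal := by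
  rw [eval_tensorPoint]
  exact Ideal.algebraMap_residueField_eq_zero

theorem isNoetherianOn_tensorPoint_mem {C : Set (TensorPoint K (tensorShape d))}
    (hd : B.IsGeneratedBy (Set.range d)) (hC : TensorPoint.IsEquationallyNoetherian C) :
    B.IsNoetherianOn fun S => {p : PrimeSpectrum (B.obj S) | tensorPoint d p ∈ C} := by
  choose F hF using fun x : B.Element => polyMap_surjective d hd x.1 x.2
  let tr (x : B.Element) : TensorEquation K (tensorShape d) := ⟨x.1, F x⟩
  have htr {S : FI} (p : PrimeSpectrum (B.obj S)) (x : B.Element) :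
      (tensorPoint d p).Satisfies (tr x) ↔ ∀ σ : x.1 ⟶ S, (B.map σ).hom x.2 ∈ p.asIdeal := by
    refine ⟨fun h σ => ?_, fun h σ hσ => ?_⟩
    · simpa only [hF] using (eval_tensorPoint_eq_zero_iff d p σ (F x)).mp (h σ.1 σ.2)
    · exact (eval_tensorPoint_eq_zero_iff d p ⟨σ, hσ⟩ (F x)).mpr ((hF x).symm ▸ h ⟨σ, hσ⟩)
  intro E
  obtain ⟨E₀, hsub, hfin, hE⟩ := Set.exists_subset_image_finite_and.mp (hC (tr '' E))
  refine ⟨E₀, hsub, hfin, fun S p ⟨hp, hpE⟩ x hx => (htr p x).mp (hE _ hp ?_ _ ⟨x, hx, rfl⟩)⟩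
  rintro _ ⟨x, hx, rfl⟩
  exact (htr p x).mpr (hpE x hx)

/-- The universal minor with pattern `s` of the flattening along `w` of the tensor formed by the
images of `x`. -/
noncomputable def minorElement (x : B.Element) (w : x.1.carrier) {r : ℕ}
    (s : TensorPoint.MinorPattern x.1.carrier r) : B.Element :=
  ⟨FI.of (Quotient s),
    (Flattening.block (translate x (FI.of (Quotient s))) w s.row s.col).det⟩

/-- The universal admissible minors of size `r` of the flattenings of the tensors formed by the
images of the elements `d`. -/
def minorElements (r : ℕ) : Set B.Element :=
  {x | ∃ (j : J) (w : tensorShape d j) (s : TensorPoint.MinorPattern (tensorShape d j) r),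
    Flattening.IsAdmissible w s.row s.col ∧ x = minorElement (d j) w s}

theorem finite_minorElements [Finite J] (r : ℕ) : (minorElements d r).Finite := by
  refine (Set.finite_range fun q : Σ j, tensorShape d j ×
    TensorPoint.MinorPattern (tensorShape d j) r => minorElement (d q.1) q.2.1 q.2.2).subset ?_
  rintro _ ⟨j, w, s, -, rfl⟩
  exact ⟨⟨j, w, s⟩, rfl⟩

theorem tensorPoint_mem_rankLE {S : FI} {p : PrimeSpectrum (B.obj S)} {N : ℕ}
    (hp : p ∈ B.zeroLocus (minorElements d (N + 1)) S) :
    tensorPoint d p ∈ TensorPoint.rankLE K (tensorShape d) N := by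
  intro j w a c hac
  obtain ⟨s, ι, hι, rfl, rfl⟩ := TensorPoint.MinorPattern.exists_eq_comp a c
  let σ : FI.of (Quotient s) ⟶ S := ⟨ι, hι⟩
  let φ := (algebraMap (B.obj S) p.asIdeal.ResidueField).comp (B.map σ).hom.toRingHom
  have hblock : (Flattening.block (translate (d j) (FI.of (Quotient s))) w s.row s.col).map φ =
      Flattening.block ((tensorPoint d p).y j) w (ι ∘ s.row) fun m => ι ∘ s.col m :=
    Flattening.map_block φ ι (fun _ _ => congrArg (algebraMap (B.obj S) p.asIdeal.ResidueField)
      (map_translate (d j) σ _)) _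
  have hminor : (B.map σ).hom (minorElement (d j) w s).2 ∈ p.asIdeal :=
    hp _ ⟨j, w, s, hac.of_comp, rfl⟩ σ
  rw [← hblock]
  exact (φ.map_det _).symm.trans (Ideal.algebraMap_residueField_eq_zero.mpr hminor)

theorem minorElement_mem_ker {A : FIAlgebra K} {φ : B ⟶ A} {x : B.Element} {w : x.1.carrier}
    {r : ℕ} {s : TensorPoint.MinorPattern x.1.carrier r}
    (hs : Flattening.IsAdmissible w s.row s.col)
    (h : Flattening.MinorsVanish (translate (mapElement φ x) (FI.of (Quotient s))) w r) :
    (minorElement x w s).2 ∈ (ker φ).obj (minorElement x w s).1 := by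
  let T : FI := FI.of (Quotient s)
  have hblock : (Flattening.block (translate x T) w s.row s.col).map (φ.app T).hom.toRingHom =
      Flattening.block (translate (mapElement φ x) T) w s.row s.col :=
    Flattening.map_block (φ.app T).hom.toRingHom id (fun _ _ => app_translate φ x T _) s.row
  refine (RingHom.map_det (φ.app T).hom.toRingHom _).trans ?_
  rw [RingHom.mapMatrix_apply, hblock]
  exact h s.row s.col hs

theorem exists_minorElements_mem_ker [Finite J] {A : FIAlgebra K} (hA : A.IsGeneratedInWidthLE 1)
    (φ : B ⟶ A) : ∃ N, ∀ x ∈ minorElements d (N + 1), x.2 ∈ (ker φ).obj x.1 := by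
  choose n hn using fun q : Σ j, tensorShape d j =>
    hA.exists_minorsVanish_translate (mapElement φ (d q.1)) q.2
  obtain ⟨N, hN⟩ := (Set.finite_range n).bddAbove
  refine ⟨N, ?_⟩
  rintro _ ⟨j, w, s, hs, rfl⟩
  exact minorElement_mem_ker hs
    (hn ⟨j, w⟩ _ _ (Nat.lt_succ_of_le (hN ⟨⟨j, w⟩, rfl⟩)))

end Tensors

/-! ### FI-ideals and zero loci -/

section Ideals

variable {K : Type u} [CommRing K] {A B : FIAlgebra K}

theorem mem_support_imageClosure_specMap (φ : B ⟶ A) {S : FI} (p : PrimeSpectrum (B.obj S)) :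
    p ∈ (FIOpScheme.imageClosure (specMap φ)).support S ↔ (ker φ).obj S ≤ p.asIdeal := by
  rw [FIOpScheme.support_imageClosure]
  change p ∈ closure (Set.range (PrimeSpectrum.comap (φ.app S).hom.toRingHom)) ↔ _
  rw [PrimeSpectrum.closure_range_comap]
  rfl

theorem FIIdeal.radical_eq_iff {I J : B.FIIdeal} : I.radical = J.radical ↔
    ∀ (S : FI) (p : PrimeSpectrum (B.obj S)), I.obj S ≤ p.asIdeal ↔ J.obj S ≤ p.asIdeal := by
  constructor
  · intro h S p
    have hS : (I.obj S).radical = (J.obj S).radical := congrArg (fun I => FIIdeal.obj I S) h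
    rw [← p.2.radical_le_iff, hS, p.2.radical_le_iff]
  · intro h
    refine FIIdeal.ext (funext fun S => ?_)
    change (I.obj S).radical = (J.obj S).radical
    rw [Ideal.radical_eq_sInf, Ideal.radical_eq_sInf]
    congr 1
    ext P
    exact and_congr_left fun hP => h S ⟨P, hP⟩

/-- The FI-ideal generated by a set of elements. -/
def FIIdeal.span (D : Set B.Element) : B.FIIdeal where
  obj S := Ideal.span {b | ∃ x ∈ D, ∃ σ : x.1 ⟶ S, (B.map σ).hom x.2 = b}
  map_mem {S T} f a ha := by
    refine Ideal.mem_comap.mp (Ideal.span_le.mpr ?_ ha)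
    rintro _ ⟨x, hx, σ, rfl⟩
    exact Ideal.subset_span ⟨x, hx, σ ≫ f, (map_map_apply B σ f x.2).symm⟩

theorem FIIdeal.isFinitelyGenerated_span {D : Set B.Element} (hD : D.Finite) :
    (FIIdeal.span D).IsFinitelyGenerated := by
  refine ⟨D, hD, fun x hx => Ideal.subset_span ⟨x, hx, 𝟙 _, map_id_apply B x.2⟩,
    fun J hJ S => Ideal.span_le.mpr ?_⟩
  rintro _ ⟨x, hx, σ, rfl⟩
  exact J.map_mem σ (hJ x hx)

theorem FIIdeal.span_le_iff_mem_zeroLocus {D : Set B.Element} {S : FI}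
    {p : PrimeSpectrum (B.obj S)} :
    (FIIdeal.span D).obj S ≤ p.asIdeal ↔ p ∈ B.zeroLocus D S := by
  refine Ideal.span_le.trans ⟨fun h x hx σ => h ⟨x, hx, σ, rfl⟩, ?_⟩
  rintro h _ ⟨x, hx, σ, rfl⟩
  exact h x hx σ

theorem FIIdeal.mem_zeroLocus_of_le {I : B.FIIdeal} {D : Set B.Element}
    (hD : ∀ x ∈ D, x.2 ∈ I.obj x.1) {S : FI} {p : PrimeSpectrum (B.obj S)}
    (hp : I.obj S ≤ p.asIdeal) : p ∈ B.zeroLocus D S :=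
  fun x hx σ => hp (I.map_mem σ (hD x hx))

theorem IsNoetherianOn.exists_finite_le_iff_mem_zeroLocus {I : B.FIIdeal} {D : Set B.Element}
    (hD : B.IsNoetherianOn (B.zeroLocus D)) (hfin : D.Finite) (hI : ∀ x ∈ D, x.2 ∈ I.obj x.1) :
    ∃ D' : Set B.Element, D'.Finite ∧ ∀ (S : FI) (p : PrimeSpectrum (B.obj S)),
      I.obj S ≤ p.asIdeal ↔ p ∈ B.zeroLocus D' S := by
  obtain ⟨E₀, hsub, hfin₀, hE⟩ := hD {x | x.2 ∈ I.obj x.1}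
  refine ⟨D ∪ E₀, hfin.union hfin₀, fun S p => ⟨fun hp => ?_, fun hp b hb => ?_⟩⟩
  · exact FIIdeal.mem_zeroLocus_of_le (fun x hx => hx.elim (hI x) fun hx => hsub hx) hp
  · have hpE := hE S ⟨fun x hx => hp x (Or.inl hx), fun x hx => hp x (Or.inr hx)⟩
    exact map_id_apply B b ▸ hpE ⟨S, b⟩ hb (𝟙 S)

theorem exists_finite_isNoetherianOn_zeroLocus [IsNoetherianRing K] (hB : B.IsFinitelyGenerated)
    (hA : A.IsGeneratedInWidthLE 1) (φ : B ⟶ A) :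
    ∃ D : Set B.Element, D.Finite ∧ (∀ x ∈ D, x.2 ∈ (ker φ).obj x.1) ∧
      B.IsNoetherianOn (B.zeroLocus D) := by
  obtain ⟨G, hfin, hG⟩ := hB
  obtain ⟨m, d, -, rfl⟩ := hfin.fin_param
  obtain ⟨N, hN⟩ := exists_minorElements_mem_ker d hA φ
  exact ⟨minorElements d (N + 1), finite_minorElements d _, hN,
    (isNoetherianOn_tensorPoint_mem d hG (TensorPoint.isEquationallyNoetherian_rankLE N)).mono
      fun _ _ => tensorPoint_mem_rankLE d⟩

/-- The elements of `B` that vanish on the subsets `V S` of `Spec B(S)`. -/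
def vanishingElements (V : ∀ S : FI, Set (PrimeSpectrum (B.obj S))) : Set B.Element :=
  {x | ∀ p ∈ V x.1, x.2 ∈ p.asIdeal}

theorem vanishingElements_antitone : Antitone (vanishingElements (B := B)) :=
  fun _ _ hV x hx p hp => hx p (hV x.1 hp)

theorem zeroLocus_vanishingElements {V : ∀ S : FI, Set (PrimeSpectrum (B.obj S))}
    (hclosed : ∀ S, IsClosed (V S))
    (hmap : ∀ {S T : FI} (f : S ⟶ T), ∀ p ∈ V T,
      PrimeSpectrum.comap (B.map f).hom.toRingHom p ∈ V S)
    (S : FI) : B.zeroLocus (vanishingElements V) S = V S := by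
  refine Set.Subset.antisymm (fun p hp => ?_) fun p hp x hx σ => hx _ (hmap σ p hp)
  rw [← (hclosed S).closure_eq, ← PrimeSpectrum.zeroLocus_vanishingIdeal_eq_closure]
  intro b hb
  have hbp := hp ⟨S, b⟩ (fun q hq => (PrimeSpectrum.mem_vanishingIdeal _ _).mp hb q hq) (𝟙 S)
  exact map_id_apply B b ▸ hbp

end Ideals

end FIAlgebra

/-! ### Reduced closed subschemes -/

theorem vanishingIdeal_support_of_isReduced {X : Scheme.{u}} (I : X.IdealSheafData)
    [IsReduced I.subscheme] : Scheme.IdealSheafData.vanishingIdeal I.support = I := by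
  have h := Scheme.IdealSheafData.map_vanishingIdeal I.subschemeι ⊤
  rw [Scheme.IdealSheafData.vanishingIdeal_top, Scheme.nilradical_eq_bot,
    Scheme.IdealSheafData.map_bot, Scheme.IdealSheafData.ker_subschemeι] at h
  refine Eq.trans (congrArg _ (TopologicalSpace.Closeds.ext ?_)) h.symm
  simp [Scheme.IdealSheafData.range_subschemeι, I.support.isClosed.closure_eq]

namespace FIOpScheme.ClosedSubscheme

variable {K : Type u} [CommRing K] {X : FIOpScheme K}

theorem res_mem_support (Z : X.ClosedSubscheme) {S T : FI} (f : S ⟶ T) {x : X.at_ T}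
    (hx : x ∈ Z.support T) : X.res f x ∈ Z.support S := by
  obtain ⟨g, hg⟩ := Z.exists_restriction f
  rw [support, ← Scheme.IdealSheafData.range_subschemeι] at hx ⊢
  obtain ⟨z, rfl⟩ := hx
  refine ⟨g z, ?_⟩
  rw [← Scheme.Hom.comp_apply, ← Scheme.Hom.comp_apply, hg]

theorem IsReduced.ext {Z Z' : X.ClosedSubscheme} (hZ : Z.IsReduced) (hZ' : Z'.IsReduced)
    (h : ∀ S, Z.support S = Z'.support S) : Z = Z' := by
  refine ClosedSubscheme.ext (funext fun S => ?_)
  have := hZ S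
  have := hZ' S
  rw [← vanishingIdeal_support_of_isReduced (Z.ideal S),
    ← vanishingIdeal_support_of_isReduced (Z'.ideal S)]
  exact congrArg _ (TopologicalSpace.Closeds.ext (h S))

theorem support_subset_of_le {Z Z' : X.ClosedSubscheme} (h : Z ≤ Z') (S : FI) :
    Z.support S ⊆ Z'.support S :=
  Scheme.IdealSheafData.support_antitone (h S)

/-- The closed immersion of a closed subscheme. -/
noncomputable def ι (Z : X.ClosedSubscheme) (S : FI) : Z.toFIOpScheme.at_ S ⟶ X.at_ S :=
  (Z.ideal S).subschemeι

theorem isClosedEmbedding_ι (Z : X.ClosedSubscheme) (S : FI) :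
    Topology.IsClosedEmbedding (Z.ι S) :=
  (Z.ideal S).subschemeι.isClosedEmbedding

theorem range_ι (Z : X.ClosedSubscheme) (S : FI) : Set.range (Z.ι S) = Z.support S :=
  Scheme.IdealSheafData.range_subschemeι _

theorem res_ι_apply (Z : X.ClosedSubscheme) {S T : FI} (f : S ⟶ T) (z : Z.toFIOpScheme.at_ T) :
    X.res f (Z.ι T z) = Z.ι S (Z.toFIOpScheme.res f z) := by
  have h : Z.toFIOpScheme.res f ≫ Z.ι S = Z.ι T ≫ X.res f := (Z.exists_restriction f).choose_spec
  rw [← Scheme.Hom.comp_apply, ← Scheme.Hom.comp_apply, h]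

end FIOpScheme.ClosedSubscheme

namespace FIAlgebra

variable {K : Type u} [CommRing K] {B : FIAlgebra K}

/-- The points of a closed subscheme of a closed subscheme of `Spec B`, as points of `Spec B`. -/
def imageSupport {Y : B.spec.ClosedSubscheme} (Z : Y.toFIOpScheme.ClosedSubscheme) (S : FI) :
    Set (PrimeSpectrum (B.obj S)) :=
  Y.ι S '' Z.support S

theorem zeroLocus_vanishingElements_imageSupport {Y : B.spec.ClosedSubscheme}
    (Z : Y.toFIOpScheme.ClosedSubscheme) (S : FI) :
    B.zeroLocus (vanishingElements (imageSupport Z)) S = imageSupport Z S := by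
  refine zeroLocus_vanishingElements (fun S => ?_) ?_ S
  · exact (Y.isClosedEmbedding_ι S).isClosedMap _ (Z.ideal S).support.isClosed
  · rintro S T f _ ⟨z, hz, rfl⟩
    exact ⟨_, Z.res_mem_support f hz, (Y.res_ι_apply f z).symm⟩

theorem IsNoetherianOn.isTopologicallyNoetherian {Y : B.spec.ClosedSubscheme}
    (hY : B.IsNoetherianOn Y.support) : Y.toFIOpScheme.IsTopologicallyNoetherian := by
  intro Z hred hle
  have hanti (S : FI) : Antitone fun n => (Z n).support S :=
    antitone_nat_of_succ_le fun n => FIOpScheme.ClosedSubscheme.support_subset_of_le (hle n) S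
  let E (n : ℕ) : Set B.Element := vanishingElements (imageSupport (Z n))
  have hmono : Monotone E := fun m n hmn =>
    vanishingElements_antitone fun S => Set.image_mono (hanti S hmn)
  obtain ⟨E₀, hsub, hfin, hE₀⟩ := hY (⋃ n, E n)
  obtain ⟨N, hN⟩ : ∃ N, E₀ ⊆ E N := by
    simpa using hmono.directed_le.exists_mem_subset_of_finset_subset_biUnion
      (s := hfin.toFinset) (by simpa using hsub)
  have hstable (n : ℕ) (S : FI) : imageSupport (Z N) S ⊆ imageSupport (Z n) S := by
    rw [← zeroLocus_vanishingElements_imageSupport, ← zeroLocus_vanishingElements_imageSupport]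
    intro p hp x hx
    have hpY : p ∈ Y.support S := by
      rw [zeroLocus_vanishingElements_imageSupport] at hp
      exact Y.range_ι S ▸ Set.image_subset_range _ _ hp
    exact hE₀ S ⟨hpY, fun x hx => hp x (hN hx)⟩ x (Set.mem_iUnion_of_mem n hx)
  refine ⟨N, fun n hn => (hred n).ext (hred N) fun S => (hanti S hn).antisymm ?_⟩
  exact (Set.image_subset_image_iff (Y.isClosedEmbedding_ι S).injective).mp (hstable n S)

end FIAlgebra

theorem mainTheorem1_general {K : Type u} [CommRing K] [IsNoetherianRing K] (B A : FIAlgebra K)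
    (hB : B.IsFinitelyGenerated) (hA : A.IsGeneratedInWidthLE 1) (φ : B ⟶ A) :
    (∃ D : Set B.Element, D.Finite ∧
      ∀ S : FI, (FIOpScheme.imageClosure (FIAlgebra.specMap φ)).support S = B.zeroLocus D S) ∧
    (∃ I : B.FIIdeal, I.IsFinitelyGenerated ∧ I.radical = (FIAlgebra.ker φ).radical) ∧
    (FIOpScheme.imageClosure (FIAlgebra.specMap φ)).toFIOpScheme.IsTopologicallyNoetherian := by
  obtain ⟨D₀, hfin₀, hker, hnoeth⟩ := FIAlgebra.exists_finite_isNoetherianOn_zeroLocus hB hA φ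
  obtain ⟨D, hfin, hD⟩ := hnoeth.exists_finite_le_iff_mem_zeroLocus hfin₀ hker
  have hsupport (S : FI) (p : PrimeSpectrum (B.obj S)) :=
    FIAlgebra.mem_support_imageClosure_specMap φ p
  refine ⟨⟨D, hfin, fun S => Set.ext fun p => (hsupport S p).trans (hD S p)⟩,
    ⟨.span D, FIAlgebra.FIIdeal.isFinitelyGenerated_span hfin, ?_⟩,
    (hnoeth.mono fun S p hp => ?_).isTopologicallyNoetherian⟩
  · exact FIAlgebra.FIIdeal.radical_eq_iff.mpr fun S p =>
      FIAlgebra.FIIdeal.span_le_iff_mem_zeroLocus.trans (hD S p).symm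
  · exact FIAlgebra.FIIdeal.mem_zeroLocus_of_le hker ((hsupport S p).mp hp)

theorem mainTheorem1 {K : Type u} [CommRing K] [IsNoetherianRing K] (B A : FIAlgebra K)
    (hB : B.IsFinitelyGenerated) (hA : A.IsFinitelyGenerated) (hA1 : A.IsGeneratedInWidthLE 1)
    (φ : B ⟶ A) :
    (∃ D : Set B.Element, D.Finite ∧
      ∀ S : FI, (FIOpScheme.imageClosure (FIAlgebra.specMap φ)).support S = B.zeroLocus D S) ∧
    (∃ I : B.FIIdeal, I.IsFinitelyGenerated ∧ I.radical = (FIAlgebra.ker φ).radical) ∧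
    (FIOpScheme.imageClosure (FIAlgebra.specMap φ)).toFIOpScheme.IsTopologicallyNoetherian :=
  mainTheorem1_general B A hB hA1 φ
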